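/- Let $I$ be an ideal of finite codimension in $\mathbb{C}[[x,y]]$ (that is, $\dim_{\mathbb C}\mathbb{C}[[x,y]]/I<\infty$), let $\mathfrak m=(x,y)$, and let $m(I)$ be the largest $k\in\mathbb N$ with $I\subseteq\mathfrak m^k$. Then the set $\mathcal D(I)$ of dicritical vertices of the Newton tree of $I$ is finite and $$m(I)=\sum_{v\in\mathcal D(I)}\rho(v)\,d_v .$$ The notions are the following, for a nonzero ideal $J\subseteq\mathbb{C}[[x,y]]$. *Faces.* Let $\Delta(J)\subseteq\mathbb R^2$ be the smallest convex set containing $E+\mathbb R_{\ge0}^2$, where $E\subseteq\mathbb N^2$ is the union of the supports of the elements of $J$. The faces of the Newton polygon of $J$ are the one-dimensional compact faces $S$ of $\Delta(J)$; the supporting line of $S$ has an equation $p_S\alpha+q_S\beta=N_S$ with $p_S,q_S\ge1$ coprime. The initial ideal $\mathrm{in}(J,S)$ is generated by the initial parts $\sum_{p_S\alpha+q_S\beta=N_S}c_{\alpha\beta}x^\alpha y^\beta$ of the elements $f=\sum c_{\alpha\beta}x^\alpha y^\beta$ of $J$. It can be written $$\mathrm{in}(J,S)=x^{a}y^{b}F_{J,S}(x^{q_S},y^{p_S})\bigl(k_1(x^{q_S},y^{p_S}),\dots,k_s(x^{q_S},y^{p_S})\bigr),$$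 where $F_{J,S}$ (the face polynomial) is homogeneous, monic in $y$ and divisible by neither $x$ nor $y$, and $k_1,\dots,k_s$ are coprime homogeneous polynomials of the same degree $d_S\ge0$. *Newton maps.* For coprime $p,q\ge1$ and $\mu\in\mathbb C^*$, let $p',q'\in\mathbb N$ be the unique numbers with $pp'-qq'=1$, $p'\le q$, $q'<p$. The Newton map $\sigma=\sigma_{(p,q,\mu)}$ is the endomorphism $f(x,y)\mapsto f\bigl(\mu^{q'}x^p,\,x^q(y+\mu^{p'})\bigr)$ of $\mathbb C[[x,y]]$, and $J_\sigma$ is the ideal generated by $\sigma(J)$. *Newton tree.* If $J=(x^k(y+h(x))^\nu)$ with $k,\nu\in\mathbb N$ and $h\in x\mathbb C[[x]]$, its Newton tree has no vertices. Otherwise its vertices are the faces $S$ of the Newton polygon of $J$ together with, for each such $S$ and each root $\mu$ of $F_{J,S}(1,\cdot)$, the vertices of the Newton tree of $J_\sigma$, $\sigma=\sigma_{(p_S,q_S,\mu)}$; the latter tree is attached to the vertex $S$. Thus each vertex $v$ of the Newton tree of $I$ is given by a sequence of such Newton maps $\sigma_{(p_1,q_1,\mu_1)},\dots,\sigma_{(p_n,q_n,\mu_n)}$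 ($n\ge0$), performed successively on $I$, and a face $S$ of the Newton polygon of the resulting ideal. Put $d_v=d_S$ and call $v$ dicritical if $d_v>0$. Finally, $$\rho(v)=\min\{p_1p_2\cdots p_n\,p_S,\ q_1p_2\cdots p_n\,p_S\}\ \text{ if } n\ge1,\qquad \rho(v)=\min\{p_S,q_S\}\ \text{ if } n=0 .$$ -/

import Mathlib

namespace NewtonTree

open MvPowerSeries

/-- The ring `ℂ[[x,y]]`, with `x = X 0` and `y = X 1`. -/
abbrev PS : Type := MvPowerSeries (Fin 2) ℂ

/-! ### Newton diagrams and faces -/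

/-- The union of the supports of the elements of `I`, as a set of exponents `(α, β) = (n 0, n 1)`. -/
def supp (I : Ideal PS) : Set (Fin 2 →₀ ℕ) :=
  {n | ∃ f ∈ I, coeff n f ≠ 0}

/-- The Newton diagram `Δ(E)`: the smallest convex set containing `E + ℝ₊²`. -/
def diagram (E : Set (Fin 2 →₀ ℕ)) : Set (ℝ × ℝ) :=
  convexHull ℝ {P | ∃ n ∈ E, ∃ b : ℝ × ℝ, 0 ≤ b.1 ∧ 0 ≤ b.2 ∧ P = ((n 0 : ℝ) + b.1, (n 1 : ℝ) + b.2)}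

/-- The line `p α + q β = N` in the plane with coordinates `(α, β)`. -/
@[ext] structure Line where
  p : ℕ
  q : ℕ
  N : ℕ

/-- `L` is, in normalized form, the supporting line of a face `S` of the Newton polygon of `I`,
that is, of a one-dimensional compact face of the Newton diagram `Δ(I)`: the line has positive
coprime coefficients, `Δ(I)` lies on one side of it, and the intersection `S` of `Δ(I)` with the
line has at least two points. A face is identified with its supporting line. -/
def IsFace (I : Ideal PS) (L : Line) : Prop :=
  0 < L.p ∧ 0 < L.q ∧ Nat.Coprime L.p L.q ∧
  (∀ P ∈ diagram (supp I), (L.N : ℝ) ≤ L.p * P.1 + L.q * P.2) ∧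
  {P ∈ diagram (supp I) | (L.p : ℝ) * P.1 + L.q * P.2 = L.N}.Nontrivial

/-- The initial part `in(f, L)`: the sum of the terms of `f` with exponents on the line `L`. -/
noncomputable def initialPart (L : Line) (f : PS) : PS :=
  fun n => if L.p * n 0 + L.q * n 1 = L.N then coeff n f else 0

/-- The initial ideal `in(I, S)`. -/
noncomputable def initialIdeal (I : Ideal PS) (L : Line) : Ideal PS :=
  Ideal.span (initialPart L '' (I : Set PS))

/-- `F` is the face polynomial and `d` the degree of the face with supporting line `L`:
`in(I, S) = x^a y^b F(x^q, y^p) (k₁(x^q, y^p), …, k_s(x^q, y^p))`,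
with `F` homogeneous, monic in `y`, not divisible by `x` or `y`, and `k₁, …, k_s` coprime and
homogeneous of the same degree `d`. The case of a principal initial ideal is `s = 1`, `k₁ = 1`,
and then `d = 0`. -/
def IsFaceData (I : Ideal PS) (L : Line) (F : MvPolynomial (Fin 2) ℂ) (d : ℕ) : Prop :=
  (∃ n : ℕ, F.IsHomogeneous n ∧ F.coeff (Finsupp.single 1 n) = 1) ∧
  ¬ MvPolynomial.X 0 ∣ F ∧ ¬ MvPolynomial.X 1 ∣ F ∧
  ∃ (a b s : ℕ) (k : Fin s → MvPolynomial (Fin 2) ℂ),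
    (∀ i, (k i).IsHomogeneous d) ∧
    (∀ g : MvPolynomial (Fin 2) ℂ, (∀ i, g ∣ k i) → IsUnit g) ∧
    initialIdeal I L = Ideal.span (Set.range fun i : Fin s =>
      (X 0 : PS) ^ a * (X 1 : PS) ^ b *
        MvPolynomial.aeval ![(X 0 : PS) ^ L.q, (X 1 : PS) ^ L.p] F *
        MvPolynomial.aeval ![(X 0 : PS) ^ L.q, (X 1 : PS) ^ L.p] (k i))

/-! ### Newton maps -/

/-- The data of a Newton map `σ_(p,q,μ)`. The numbers `p'`, `q'` are the unique natural numbers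
with `p p' - q q' = 1`, `p' ≤ q` and `q' < p`; the first equation forces `gcd(p,q) = 1`. -/
structure NewtonMap where
  p : ℕ
  q : ℕ
  μ : ℂ
  p' : ℕ
  q' : ℕ
  p_pos : 0 < p
  q_pos : 0 < q
  μ_ne_zero : μ ≠ 0
  bezout : p * p' = q * q' + 1
  p'_le : p' ≤ q
  q'_lt : q' < p

/-- The power series `μ^{q'} x^p` and `x^q (y + μ^{p'})` to be substituted for `x` and `y`. -/
noncomputable def NewtonMap.image (σ : NewtonMap) : Fin 2 → PS :=
  ![C (σ.μ ^ σ.q') * X 0 ^ σ.p, X 0 ^ σ.q * (X 1 + C (σ.μ ^ σ.p'))]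

theorem NewtonMap.hasSubst_image (σ : NewtonMap) : HasSubst σ.image := by
  apply hasSubst_of_constantCoeff_zero
  intro i
  have hp := σ.p_pos.ne'
  have hq := σ.q_pos.ne'
  fin_cases i <;> simp [NewtonMap.image, hp, hq]

/-- The Newton map `f(x,y) ↦ f(μ^{q'} x^p, x^q (y + μ^{p'}))`, an endomorphism of `ℂ[[x,y]]`. -/
noncomputable def NewtonMap.hom (σ : NewtonMap) : PS →ₐ[ℂ] PS :=
  substAlgHom σ.hasSubst_image

/-- The ideal `I_σ` generated by the image of `I` under the Newton map `σ`. -/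
noncomputable def NewtonMap.transform (σ : NewtonMap) (I : Ideal PS) : Ideal PS :=
  I.map σ.hom

/-! ### The Newton tree -/

/-- Depth zero: `I` is generated by `x^k (y + h(x))^ν` with `h ∈ x ℂ[[x]]`. -/
def IsDepthZero (I : Ideal PS) : Prop :=
  ∃ (k ν : ℕ) (h : PS), (∀ n : Fin 2 →₀ ℕ, n 1 ≠ 0 → coeff n h = 0) ∧
    constantCoeff h = 0 ∧ I = Ideal.span {(X 0 : PS) ^ k * (X 1 + h) ^ ν}

/-- `σ = σ_(p,q,μ)` is one of the Newton maps performed on `I`: `(p,q)` belongs to a face of the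
Newton polygon of `I`, and `μ` is a root of its face polynomial. -/
def IsStep (I : Ideal PS) (σ : NewtonMap) : Prop :=
  ∃ (N : ℕ) (F : MvPolynomial (Fin 2) ℂ) (d : ℕ),
    IsFace I ⟨σ.p, σ.q, N⟩ ∧ IsFaceData I ⟨σ.p, σ.q, N⟩ F d ∧ MvPolynomial.eval ![1, σ.μ] F = 0

/-- A vertex of the tree, specified by the sequence `Σ` of Newton maps that leads to it (empty for
a face of the Newton polygon of `I` itself), the corresponding face of the Newton polygon of
`I_Σ`, and the degree `d` of that face. -/
@[ext] structure Vertex where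
  path : List NewtonMap
  face : Line
  d : ℕ

/-- The Newton tree of `I` has a vertex that is reached by the sequence of Newton maps `Σ`, with
face `L` and degree `d`. An ideal of depth zero has no vertices. Otherwise there is one vertex for
each face of the Newton polygon of `I`, together with the vertices of the trees of the `I_σ`,
where `σ` runs through the Newton maps performed on `I`. -/
def HasVertex : Ideal PS → List NewtonMap → Line → ℕ → Prop
  | I, [], L, d => ¬ IsDepthZero I ∧ IsFace I L ∧ ∃ F, IsFaceData I L F d
  | I, σ :: l, L, d => ¬ IsDepthZero I ∧ IsStep I σ ∧ HasVertex (σ.transform I) l L d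

/-- The set of vertices of the Newton tree of `I`. -/
def vertices (I : Ideal PS) : Set Vertex :=
  {v | HasVertex I v.path v.face v.d}

/-- The set of dicritical vertices of the Newton tree of `I`. -/
def dicriticalVertices (I : Ideal PS) : Set Vertex :=
  {v ∈ vertices I | 0 < v.d}

/-- `ρ(v) = min {p_i p_{i-1} ⋯ p_1 p, q_i p_{i-1} ⋯ p_1 p}`, where `v_i, …, v_1, v` is the chain of
successive preceding vertices, starting on the Newton polygon of `I`. The vertex `v_i` carries
its unmodified decorations `(q_i, p_i)`, and the lower decoration `p` of a vertex is never
modified. -/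
def Vertex.rho (v : Vertex) : ℕ :=
  match v.path with
  | [] => min v.face.p v.face.q
  | σ :: l => min (σ.p * (l.map NewtonMap.p).prod * v.face.p)
      (σ.q * (l.map NewtonMap.p).prod * v.face.p)

end NewtonTree

/-!
Let `J` be an ideal of the tree and write `J = x^k J'` with a power of `x` in `J'`. Its height `ν`
is the height of the Newton polygon, hence the sum over the faces `S` of `p_S M_S`, where `M_S` is
the lattice length of `S`. On the one hand `M_S = deg F_S + d_S`; on the other hand, the height of
the transform of `J` at a root of `F_S` is the multiplicity of the root. By induction the sum of
`p₁ ⋯ pₙ p_S d_v` over the dicritical vertices is `ν`, and the sum of `ρ(v) d_v` is the sum of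
`min(p_S, q_S) M_S` over the faces of the Newton polygon of `I` itself.

It remains to see that the latter is the minimum of `α + β` on the Newton polygon. Now
`min(p, q) = p - max(p - q, 0)`, and the shear `(α, β) ↦ (α, α + β)` turns the faces with `q < p`
into the faces of a polygon with `p` replaced by `p - q`, so this follows from the formula for the
height applied to the polygon and to its shear.
-/

namespace NewtonTree

open MvPowerSeries

/-! ### Compact edges of the Newton polygon of a set of lattice points -/

section LatticePoints

variable {E : Set (ℕ × ℕ)} {L L' : Line} {a b k m ν M : ℕ}

/-- The points of `E` on the line `L`. -/
def edge (E : Set (ℕ × ℕ)) (L : Line) : Set (ℕ × ℕ) :=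
  {e ∈ E | L.p * e.1 + L.q * e.2 = L.N}

/-- `L` is the line through a compact edge of the Newton polygon of `E`: the counterpart of `IsFace`
for lattice points. -/
structure IsLatticeFace (E : Set (ℕ × ℕ)) (L : Line) : Prop where
  p_pos : 0 < L.p
  q_pos : 0 < L.q
  coprime : L.p.Coprime L.q
  le : ∀ e ∈ E, L.N ≤ L.p * e.1 + L.q * e.2
  nontrivial : (edge E L).Nontrivial

/-- The set of lines through the compact edges of the Newton polygon of `E`. -/
def latticeFaces (E : Set (ℕ × ℕ)) : Set Line :=
  {L | IsLatticeFace E L}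

theorem IsLatticeFace.exists_snd_lt (h : IsLatticeFace E L) :
    ∃ l ∈ edge E L, ∃ u ∈ edge E L, l.2 < u.2 := by
  obtain ⟨l, hl, u, hu, hne⟩ := h.nontrivial
  rcases lt_trichotomy l.2 u.2 with hlt | heq | hlt
  · exact ⟨l, hl, u, hu, hlt⟩
  · refine absurd (Prod.ext (Nat.eq_of_mul_eq_mul_left h.p_pos ?_) heq) hne
    have h1 := hl.2
    rw [← hu.2, heq] at h1
    exact Nat.add_right_cancel h1
  · exact ⟨u, hu, l, hl, hlt⟩

/-- The part of `E` on the line `L` has the end points `(a, b + p M)` and `(a + q M, b)`, and its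
other points divide the segment between them into multiples of the vector `(-q, p)`. -/
structure IsSegment (E : Set (ℕ × ℕ)) (L : Line) (a b M : ℕ) : Prop where
  top_mem : (a, b + L.p * M) ∈ edge E L
  bot_mem : (a + L.q * M, b) ∈ edge E L
  exists_eq : ∀ e ∈ edge E L, ∃ j ≤ M, e = (a + L.q * (M - j), b + L.p * j)

theorem IsLatticeFace.exists_isSegment (h : IsLatticeFace E L) : ∃ a b M, IsSegment E L a b M := by
  classical
  obtain ⟨l, hl, hmin⟩ : ∃ l ∈ edge E L, ∀ e ∈ edge E L, l.2 ≤ e.2 := by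
    obtain ⟨b, ⟨l, hl, hlb⟩, hle⟩ := exists_minimal_of_wellFoundedLT (· ∈ Prod.snd '' edge E L)
      (h.nontrivial.nonempty.image _)
    refine ⟨l, hl, fun e he => ?_⟩
    have := hle (Set.mem_image_of_mem _ he)
    omega
  have hstep : ∀ e ∈ edge E L, ∃ j, l.1 = e.1 + L.q * j ∧ e.2 = l.2 + L.p * j := by
    intro e he
    obtain ⟨t, ht⟩ := Nat.exists_eq_add_of_le (hmin e he)
    have heq : L.p * l.1 = L.p * e.1 + L.q * t := by
      have h1 := hl.2
      rw [← he.2, ht, mul_add] at h1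
      omega
    obtain ⟨j, rfl⟩ : L.p ∣ t := h.coprime.dvd_of_dvd_mul_left
      ((Nat.dvd_add_right (Dvd.intro _ rfl)).1 (heq ▸ Dvd.intro _ rfl))
    refine ⟨j, Nat.eq_of_mul_eq_mul_left h.p_pos ?_, ht⟩
    rw [heq]; ring
  let P : ℕ → Prop := fun j => ∃ e ∈ edge E L, l.1 = e.1 + L.q * j ∧ e.2 = l.2 + L.p * j
  have hbound : ∀ j, P j → j ≤ l.1 := by
    rintro j ⟨e, -, he, -⟩
    have := Nat.le_mul_of_pos_left j h.q_pos
    omega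
  obtain ⟨u, hu, hu1, hu2⟩ : P (Nat.findGreatest P l.1) :=
    Nat.findGreatest_spec (m := 0) (Nat.zero_le _) ⟨l, hl, by simp⟩
  refine ⟨u.1, l.2, Nat.findGreatest P l.1, ?_, ?_, fun e he => ?_⟩
  · rwa [← hu2]
  · rwa [← hu1]
  · obtain ⟨j, hj1, hj2⟩ := hstep e he
    have hj : j ≤ Nat.findGreatest P l.1 :=
      Nat.le_findGreatest (hbound j ⟨e, he, hj1, hj2⟩) ⟨e, he, hj1, hj2⟩
    refine ⟨j, hj, Prod.ext ?_ hj2⟩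
    have := Nat.mul_le_mul_left L.q hj
    rw [Nat.mul_sub]
    omega

theorem IsSegment.snd_mem_Icc (h : IsSegment E L a b M) {e : ℕ × ℕ} (he : e ∈ edge E L) :
    e.2 ∈ Set.Icc b (b + L.p * M) := by
  obtain ⟨j, hj, rfl⟩ := h.exists_eq e he
  exact ⟨Nat.le_add_right _ _, Nat.add_le_add_left (Nat.mul_le_mul_left _ hj) _⟩

theorem IsSegment.length_unique {a' b' M' : ℕ} (hL : 0 < L.p) (h : IsSegment E L a b M)
    (h' : IsSegment E L a' b' M') : M = M' := by
  obtain rfl : b = b' :=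
    le_antisymm (h.snd_mem_Icc h'.bot_mem).1 (h'.snd_mem_Icc h.bot_mem).1
  have h1 := (h.snd_mem_Icc h'.top_mem).2
  have h2 := (h'.snd_mem_Icc h.top_mem).2
  exact Nat.eq_of_mul_eq_mul_left hL (by omega)

/-- The number of primitive lattice steps between the ends of the edge of `E` on the line `L`; it
has junk values when `L` is not a face. -/
noncomputable def latticeLength (E : Set (ℕ × ℕ)) (L : Line) : ℕ :=
  sInf {M | ∃ a b, IsSegment E L a b M}

theorem IsSegment.latticeLength_eq (h : IsSegment E L a b M) (hL : 0 < L.p) :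
    latticeLength E L = M := by
  obtain ⟨a', b', h'⟩ := Nat.sInf_mem (s := {M | ∃ a b, IsSegment E L a b M}) ⟨M, a, b, h⟩
  exact h'.length_unique hL h

/-! ### The faces partition the heights of the Newton polygon -/

/-- The half-integral heights `h - 1/2` that the edge of `E` on the line `L` crosses, recorded
as `h`. -/
def edgeHeights (E : Set (ℕ × ℕ)) (L : Line) : Set ℕ :=
  {h | ∃ l ∈ edge E L, ∃ u ∈ edge E L, l.2 < h ∧ h ≤ u.2}

theorem IsSegment.edgeHeights_eq (h : IsSegment E L a b M) :
    edgeHeights E L = Set.Ioc b (b + L.p * M) := by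
  ext i
  constructor
  · rintro ⟨l, hl, u, hu, hlt, hle⟩
    exact ⟨(h.snd_mem_Icc hl).1.trans_lt hlt, hle.trans (h.snd_mem_Icc hu).2⟩
  · rintro ⟨hlt, hle⟩
    exact ⟨_, h.bot_mem, _, h.top_mem, hlt, hle⟩

theorem IsLatticeFace.ncard_edgeHeights (h : IsLatticeFace E L) :
    (edgeHeights E L).ncard = L.p * latticeLength E L := by
  obtain ⟨a, b, M, hM⟩ := h.exists_isSegment
  rw [hM.edgeHeights_eq, hM.latticeLength_eq h.p_pos, ← Finset.coe_Ioc, Set.ncard_coe_finset,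
    Nat.card_Ioc, Nat.add_sub_cancel_left]

theorem IsLatticeFace.edgeHeights_nonempty (h : IsLatticeFace E L) : (edgeHeights E L).Nonempty :=
  let ⟨l, hl, u, hu, hlt⟩ := h.exists_snd_lt
  ⟨u.2, l, hl, u, hu, hlt, le_rfl⟩

theorem IsLatticeFace.snd_le_of_slope_lt (h : IsLatticeFace E L) (h' : IsLatticeFace E L')
    (hs : L'.p * L.q < L.p * L'.q) {l u : ℕ × ℕ} (hl : l ∈ edge E L) (hu : u ∈ edge E L') :
    u.2 ≤ l.2 := by
  have h1 := h.le u hu.1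
  have h2 := h'.le l hl.1
  rw [← hl.2] at h1
  rw [← hu.2] at h2
  have h3 := Nat.mul_le_mul_left L'.p h1
  have h4 := Nat.mul_le_mul_left L.p h2
  by_contra! hcon
  zify at hs hcon h3 h4
  nlinarith [mul_pos (sub_pos.2 hs) (sub_pos.2 hcon)]

theorem IsLatticeFace.eq_of_slope_eq (h : IsLatticeFace E L) (h' : IsLatticeFace E L')
    (hs : L'.p * L.q = L.p * L'.q) : L = L' := by
  have hp : L.p = L'.p := Nat.dvd_antisymm
    (h.coprime.dvd_of_dvd_mul_right (hs ▸ Dvd.intro _ rfl))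
    (h'.coprime.dvd_of_dvd_mul_right (hs ▸ Dvd.intro _ rfl))
  have hq : L.q = L'.q := Nat.eq_of_mul_eq_mul_left h'.p_pos (hp ▸ hs)
  obtain ⟨e, he⟩ := h.nontrivial.nonempty
  obtain ⟨e', he'⟩ := h'.nontrivial.nonempty
  refine Line.ext hp hq (le_antisymm ?_ ?_)
  · rw [← he'.2, ← hp, ← hq]
    exact h.le e' he'.1
  · rw [← he.2, hp, hq]
    exact h'.le e he.1

theorem pairwiseDisjoint_edgeHeights (E : Set (ℕ × ℕ)) :
    (latticeFaces E).PairwiseDisjoint (edgeHeights E) := by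
  intro L h L' h' hne
  refine Set.disjoint_left.2 fun i hi hi' => hne ?_
  obtain ⟨l, hl, u, hu, hlt, hle⟩ := hi
  obtain ⟨l', hl', u', hu', hlt', hle'⟩ := hi'
  rcases lt_trichotomy (L'.p * L.q) (L.p * L'.q) with hs | hs | hs
  · have := h.snd_le_of_slope_lt h' hs hl hu'
    omega
  · exact h.eq_of_slope_eq h' hs
  · have := h'.snd_le_of_slope_lt h hs hl' hu
    omega

theorem exists_finset_forall_exists_le {α : Type*} [PartialOrder α] [WellFoundedLT α]
    [WellQuasiOrderedLE α] (E : Set α) : ∃ S : Finset α, ↑S ⊆ E ∧ ∀ e ∈ E, ∃ s ∈ S, s ≤ e := by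
  have hfin : {e | Minimal (· ∈ E) e}.Finite :=
    WellQuasiOrderedLE.finite_of_isAntichain (setOfPred_minimal_antichain (· ∈ E))
  refine ⟨hfin.toFinset, fun e he => (hfin.mem_toFinset.1 he).prop, fun e he => ?_⟩
  obtain ⟨s, hs, hmin⟩ := exists_minimal_le_of_wellFoundedLT (· ∈ E) e he
  exact ⟨s, hfin.mem_toFinset.2 hmin, hs⟩

/-- Among the lines through a point above and a point below the horizontal line at height `h`,
choose one that meets it as far to the left as possible. -/
theorem exists_supporting_pair {K : Type*} [Field K] [LinearOrder K] [IsStrictOrderedRing K]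
    (S : Finset (K × K)) {h : K} (hS : ∀ s ∈ S, s.2 ≠ h) {u₀ l₀ : K × K} (hu₀ : u₀ ∈ S)
    (hl₀ : l₀ ∈ S) (hhu₀ : h < u₀.2) (hhl₀ : l₀.2 < h) :
    ∃ u ∈ S, ∃ l ∈ S, h < u.2 ∧ l.2 < h ∧ ∀ w ∈ S,
      (u.2 - l.2) * l.1 + (l.1 - u.1) * l.2 ≤ (u.2 - l.2) * w.1 + (l.1 - u.1) * w.2 := by
  let abscissa : (K × K) × (K × K) → K := fun x =>
    (x.1.1 * (h - x.2.2) + x.2.1 * (x.1.2 - h)) / (x.1.2 - x.2.2)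
  obtain ⟨⟨u, l⟩, hul, hopt⟩ := Finset.exists_min_image
    ((S.filter (h < ·.2)) ×ˢ (S.filter (·.2 < h))) abscissa ⟨(u₀, l₀), by simp [*]⟩
  simp only [Finset.mem_product, Finset.mem_filter, Prod.forall, abscissa, and_imp] at hul hopt
  obtain ⟨⟨hu, hhu⟩, hl, hhl⟩ := hul
  refine ⟨u, hu, l, hl, hhu, hhl, fun w hw => ?_⟩
  rcases (hS w hw).lt_or_gt with hhw | hhw
  · have hle := hopt _ _ _ _ hu hhu hw hhw
    have heq : ∀ v : K × K, v.2 < h → (u.1 * (h - v.2) + v.1 * (u.2 - h)) / (u.2 - v.2) =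
        u.1 + (u.2 - h) * ((v.1 - u.1) / (u.2 - v.2)) := by
      intro v hv
      have : u.2 - v.2 ≠ 0 := by linarith
      field_simp
      ring
    rw [heq l hhl, heq w hhw, add_le_add_iff_left, mul_le_mul_iff_right₀ (by linarith),
      div_le_div_iff₀ (by linarith) (by linarith)] at hle
    linarith
  · have hle := hopt _ _ _ _ hw hhw hl hhl
    have heq : ∀ v : K × K, h < v.2 → (v.1 * (h - l.2) + l.1 * (v.2 - h)) / (v.2 - l.2) =
        l.1 + (h - l.2) * ((v.1 - l.1) / (v.2 - l.2)) := by
      intro v hv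
      have : v.2 - l.2 ≠ 0 := by linarith
      field_simp
      ring
    rw [heq u hhu, heq w hhw, add_le_add_iff_left, mul_le_mul_iff_right₀ (by linarith),
      div_le_div_iff₀ (by linarith) (by linarith)] at hle
    linarith

theorem exists_isLatticeFace_of_supporting {u l : ℕ × ℕ} (hu : u ∈ E) (hl : l ∈ E)
    (h1 : u.1 < l.1) (h2 : l.2 < u.2) (hle : ∀ w ∈ E,
      ((u.2 : ℤ) - l.2) * l.1 + (l.1 - u.1) * l.2 ≤ (u.2 - l.2) * w.1 + (l.1 - u.1) * w.2) :
    ∃ L, IsLatticeFace E L ∧ l ∈ edge E L ∧ u ∈ edge E L := by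
  obtain ⟨g, p, q, hg, hpq, hp, hq⟩ := Nat.exists_coprime' (m := u.2 - l.2) (n := l.1 - u.1)
    (Nat.gcd_pos_of_pos_left _ (by omega))
  have hp_pos : 0 < p := Nat.pos_of_mul_pos_right (b := g) (by omega)
  have hq_pos : 0 < q := Nat.pos_of_mul_pos_right (b := g) (by omega)
  have hp' : (u.2 : ℤ) - l.2 = p * g := by omega
  have hq' : (l.1 : ℤ) - u.1 = q * g := by omega
  have hg' : (0 : ℤ) < g := by exact_mod_cast hg
  let L : Line := ⟨p, q, p * l.1 + q * l.2⟩
  have hlL : l ∈ edge E L := ⟨hl, rfl⟩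
  have huL : u ∈ edge E L := by
    refine ⟨hu, ?_⟩
    change p * u.1 + q * u.2 = p * l.1 + q * l.2
    zify
    linear_combination q * hp' - p * hq'
  refine ⟨L, ⟨hp_pos, hq_pos, hpq, fun w hw => ?_, l, hlL, u, huL, ?_⟩, hlL, huL⟩
  · have h := hle w hw
    rw [hp', hq'] at h
    change p * l.1 + q * l.2 ≤ p * w.1 + q * w.2
    zify
    exact le_of_mul_le_mul_left (by linarith) hg'
  · rintro rfl
    exact h1.false

theorem exists_supporting_pair_nat (S : Finset (ℕ × ℕ)) {i : ℕ} {u₀ l₀ : ℕ × ℕ} (hu₀ : u₀ ∈ S)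
    (hl₀ : l₀ ∈ S) (hiu₀ : i ≤ u₀.2) (hil₀ : l₀.2 < i) :
    ∃ u ∈ S, ∃ l ∈ S, i ≤ u.2 ∧ l.2 < i ∧ ∀ w ∈ S,
      ((u.2 : ℤ) - l.2) * l.1 + (l.1 - u.1) * l.2 ≤ (u.2 - l.2) * w.1 + (l.1 - u.1) * w.2 := by
  let ι : ℕ × ℕ → ℚ × ℚ := fun e => (e.1, e.2)
  have lt_cast : ∀ n : ℕ, i ≤ n → (i : ℚ) - 1 / 2 < n := fun n hn => by
    have : (i : ℚ) ≤ n := by exact_mod_cast hn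
    linarith
  have cast_lt : ∀ n : ℕ, n < i → (n : ℚ) < i - 1 / 2 := fun n hn => by
    have : (n : ℚ) + 1 ≤ i := by exact_mod_cast hn
    linarith
  have hne : ∀ s ∈ S.image ι, s.2 ≠ (i : ℚ) - 1 / 2 := by
    simp only [Finset.mem_image, forall_exists_index, and_imp, forall_apply_eq_imp_iff₂]
    intro s _
    rcases le_or_gt i s.2 with h | h
    exacts [(lt_cast _ h).ne', (cast_lt _ h).ne]
  obtain ⟨_, huι, _, hlι, hiu, hli, hle⟩ := exists_supporting_pair (S.image ι) hne
    (Finset.mem_image_of_mem ι hu₀) (Finset.mem_image_of_mem ι hl₀) (lt_cast _ hiu₀)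
    (cast_lt _ hil₀)
  obtain ⟨u, hu, rfl⟩ := Finset.mem_image.1 huι
  obtain ⟨l, hl, rfl⟩ := Finset.mem_image.1 hlι
  refine ⟨u, hu, l, hl, not_lt.1 fun h => (cast_lt _ h).not_gt hiu,
    not_le.1 fun h => (lt_cast _ h).not_gt hli, fun w hw => ?_⟩
  have := hle _ (Finset.mem_image_of_mem ι hw)
  simp only [ι] at this
  exact_mod_cast this

theorem exists_mem_edgeHeights (hE : IsLeast (toLex '' E) (toLex (k, ν))) {c : ℕ × ℕ} (hc : c ∈ E)
    {i : ℕ} (hci : c.2 < i) (hi : i ≤ ν) : ∃ L, IsLatticeFace E L ∧ i ∈ edgeHeights E L := by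
  have hmin : ∀ e ∈ E, k < e.1 ∨ k = e.1 ∧ ν ≤ e.2 := fun e he =>
    Prod.Lex.toLex_le_toLex.1 (hE.2 (Set.mem_image_of_mem _ he))
  obtain ⟨S, hSE, hdom⟩ := exists_finset_forall_exists_le E
  have hcorner : (k, ν) ∈ S := by
    obtain ⟨s, hs, hle⟩ := hdom (k, ν) (by simpa using hE.1)
    obtain ⟨hle1, hle2⟩ := Prod.mk_le_mk.1 hle
    have := hmin s (hSE hs)
    rwa [show (k, ν) = s from Prod.ext (by omega) (by omega)]
  obtain ⟨c', hc', hcc'⟩ := hdom c hc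
  obtain ⟨u, hu, l, hl, hiu, hli, hle⟩ :=
    exists_supporting_pair_nat S hcorner hc' hi (hcc'.2.trans_lt hci)
  have hul : u.1 < l.1 := by
    have hk : k < l.1 := by have := hmin l (hSE hl); omega
    have := hle _ hcorner
    by_contra! hcon
    have h1 : (0 : ℤ) < (u.2 - l.2) * (l.1 - k) := mul_pos (by omega) (by omega)
    have h2 : (0 : ℤ) ≤ (u.1 - l.1) * (ν - l.2) := mul_nonneg (by omega) (by omega)
    linarith
  obtain ⟨L, hL, hlL, huL⟩ := exists_isLatticeFace_of_supporting (hSE hu) (hSE hl) hul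
    (hli.trans_le hiu) fun w hw => by
      obtain ⟨s, hs, hsw⟩ := hdom w hw
      refine (hle s hs).trans (add_le_add ?_ ?_)
      · exact mul_le_mul_of_nonneg_left (by exact_mod_cast hsw.1) (by omega)
      · exact mul_le_mul_of_nonneg_left (by exact_mod_cast hsw.2) (by omega)
  exact ⟨L, hL, l, hlL, u, huL, hli, hiu⟩

theorem biUnion_edgeHeights (hE : IsLeast (toLex '' E) (toLex (k, ν)))
    (hm : IsLeast (Prod.snd '' E) m) :
    ⋃ L ∈ latticeFaces E, edgeHeights E L = Set.Ioc m ν := by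
  ext i
  simp only [Set.mem_iUnion, exists_prop]
  constructor
  · rintro ⟨L, hL, l, hl, u, hu, hlt, hle⟩
    refine ⟨(hm.2 (Set.mem_image_of_mem _ hl.1)).trans_lt hlt, hle.trans ?_⟩
    have hk : k ≤ u.1 := by
      have := Prod.Lex.toLex_le_toLex.1 (hE.2 (Set.mem_image_of_mem toLex hu.1))
      simp only at this
      omega
    have h1 : L.N ≤ L.p * k + L.q * ν := hL.le _ (by simpa using hE.1)
    have h2 := Nat.mul_le_mul_left L.p hk
    refine Nat.le_of_mul_le_mul_left (c := L.q) ?_ hL.q_pos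
    have := hu.2
    omega
  · rintro ⟨hmi, hi⟩
    obtain ⟨c, hc, rfl⟩ := hm.1
    exact exists_mem_edgeHeights hE hc hmi hi

theorem finite_latticeFaces (hE : IsLeast (toLex '' E) (toLex (k, ν)))
    (hm : IsLeast (Prod.snd '' E) m) : (latticeFaces E).Finite := by
  have hU := biUnion_edgeHeights hE hm ▸ Set.finite_Ioc m ν
  exact ((pairwiseDisjoint_edgeHeights E).finite_biUnion_iff.1 hU).2.subset fun L hL =>
    ⟨hL, hL.edgeHeights_nonempty⟩

theorem finsum_p_mul_latticeLength (hE : IsLeast (toLex '' E) (toLex (k, ν)))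
    (hm : IsLeast (Prod.snd '' E) m) :
    ∑ᶠ L ∈ latticeFaces E, L.p * latticeLength E L + m = ν := by
  have hmν : m ≤ ν := hm.2 ⟨(k, ν), by simpa using hE.1, rfl⟩
  have hU := biUnion_edgeHeights hE hm
  have hcard := Set.Finite.ncard_biUnion (finite_latticeFaces hE hm)
    (fun L hL => (Set.finite_Ioc m ν).subset (hU ▸ Set.subset_biUnion_of_mem hL))
    (pairwiseDisjoint_edgeHeights E)
  rw [hU, ← Finset.coe_Ioc, Set.ncard_coe_finset, Nat.card_Ioc,
    finsum_mem_congr (s := latticeFaces E) rfl fun L hL => hL.ncard_edgeHeights] at hcard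
  omega

/-! ### The shear `(α, β) ↦ (α, α + β)` -/

/-- The shear `(α, β) ↦ (α, α + β)`, which turns the order `α + β` into a height. -/
def shear (e : ℕ × ℕ) : ℕ × ℕ :=
  (e.1, e.1 + e.2)

/-- The preimage of the line `L` under the shear. -/
def Line.unshear (L : Line) : Line :=
  ⟨L.p + L.q, L.q, L.N⟩

theorem Line.unshear_injective : Function.Injective Line.unshear := by
  rintro ⟨p, q, N⟩ ⟨p', q', N'⟩ h
  simp only [Line.unshear, Line.mk.injEq] at h ⊢
  omega

theorem shear_injective : Function.Injective shear := by
  rintro ⟨x, y⟩ ⟨x', y'⟩ h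
  simp only [shear, Prod.mk.injEq] at h ⊢
  omega

theorem unshear_form (L : Line) (e : ℕ × ℕ) :
    L.unshear.p * e.1 + L.unshear.q * e.2 = L.p * (shear e).1 + L.q * (shear e).2 := by
  simp only [Line.unshear, shear]
  ring

theorem edge_shear (E : Set (ℕ × ℕ)) (L : Line) :
    edge (shear '' E) L = shear '' edge E L.unshear := by
  ext e
  constructor
  · rintro ⟨⟨e, he, rfl⟩, heL⟩
    exact ⟨e, ⟨he, (unshear_form L e).trans heL⟩, rfl⟩
  · rintro ⟨e, ⟨he, heL⟩, rfl⟩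
    exact ⟨⟨e, he, rfl⟩, (unshear_form L e).symm.trans heL⟩

theorem isLatticeFace_shear_iff :
    IsLatticeFace (shear '' E) L ↔ 0 < L.p ∧ IsLatticeFace E L.unshear := by
  have hc : L.unshear.p.Coprime L.unshear.q ↔ L.p.Coprime L.q := Nat.coprime_add_self_left
  have hle : (∀ e ∈ E, L.unshear.N ≤ L.unshear.p * e.1 + L.unshear.q * e.2) ↔
      ∀ e ∈ shear '' E, L.N ≤ L.p * e.1 + L.q * e.2 := by
    simp only [unshear_form, Set.forall_mem_image]
    rfl
  have hn : (edge (shear '' E) L).Nontrivial ↔ (edge E L.unshear).Nontrivial := by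
    rw [edge_shear, Set.image_nontrivial shear_injective]
  exact ⟨fun h => ⟨h.p_pos, Nat.add_pos_left h.p_pos _, h.q_pos, hc.2 h.coprime, hle.2 h.le,
    hn.1 h.nontrivial⟩, fun ⟨hp, h⟩ => ⟨hp, h.q_pos, hc.1 h.coprime, hle.1 h.le,
    hn.2 h.nontrivial⟩⟩

theorem image_unshear_latticeFaces (E : Set (ℕ × ℕ)) :
    Line.unshear '' latticeFaces (shear '' E) = {L ∈ latticeFaces E | L.q < L.p} := by
  ext L
  constructor
  · rintro ⟨L, hL, rfl⟩
    have := isLatticeFace_shear_iff.1 hL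
    exact ⟨this.2, Nat.lt_add_of_pos_left this.1⟩
  · rintro ⟨hL, hlt⟩
    have heq : Line.unshear ⟨L.p - L.q, L.q, L.N⟩ = L :=
      Line.ext (Nat.sub_add_cancel hlt.le) rfl rfl
    exact ⟨_, isLatticeFace_shear_iff.2 ⟨Nat.sub_pos_of_lt hlt, heq.symm ▸ hL⟩, heq⟩

theorem IsSegment.shear (h : IsSegment E L.unshear a b M) :
    IsSegment (shear '' E) L a (a + b + L.q * M) M := by
  refine ⟨?_, ?_, ?_⟩ <;> rw [edge_shear]
  · refine ⟨_, h.top_mem, ?_⟩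
    simp only [NewtonTree.shear, Line.unshear, Prod.mk.injEq, true_and]
    ring
  · refine ⟨_, h.bot_mem, ?_⟩
    simp only [NewtonTree.shear, Line.unshear, Prod.mk.injEq, true_and]
    ring
  · rintro _ ⟨e, he, rfl⟩
    obtain ⟨j, hj, rfl⟩ := h.exists_eq e he
    obtain ⟨i, rfl⟩ := Nat.exists_eq_add_of_le hj
    refine ⟨j, hj, ?_⟩
    simp only [NewtonTree.shear, Line.unshear, Nat.add_sub_cancel_left, Prod.mk.injEq, true_and]
    ring

theorem latticeLength_shear (h : IsLatticeFace (shear '' E) L) :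
    latticeLength (shear '' E) L = latticeLength E L.unshear := by
  obtain ⟨hp, h'⟩ := isLatticeFace_shear_iff.1 h
  obtain ⟨a, b, M, hM⟩ := h'.exists_isSegment
  rw [hM.latticeLength_eq h'.p_pos, hM.shear.latticeLength_eq hp]

theorem isLeast_toLex_shear (hE : IsLeast (toLex '' E) (toLex (k, ν))) :
    IsLeast (toLex '' (shear '' E)) (toLex (k, k + ν)) := by
  refine ⟨by simpa [shear] using hE.1, ?_⟩
  rintro _ ⟨_, ⟨e, he, rfl⟩, rfl⟩
  have := Prod.Lex.toLex_le_toLex.1 (hE.2 (Set.mem_image_of_mem toLex he))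
  simp only [shear, Prod.Lex.toLex_le_toLex] at this ⊢
  omega

/-- Since `min p q = p - (p - q)` with truncated subtraction, the sum is the difference of those
for the heights of `E` and of its shear. -/
theorem finsum_min_mul_latticeLength {n : ℕ} (hE : IsLeast (toLex '' E) (toLex (k, ν)))
    (hm : IsLeast (Prod.snd '' E) m) (hn : IsLeast ((fun e => e.1 + e.2) '' E) n) :
    ∑ᶠ L ∈ latticeFaces E, min L.p L.q * latticeLength E L + m + k = n := by
  have hfin := finite_latticeFaces hE hm
  have hn' : IsLeast (Prod.snd '' (shear '' E)) n := by rwa [Set.image_image]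
  have hshear := finsum_p_mul_latticeLength (isLeast_toLex_shear hE) hn'
  have hsteep : ∑ᶠ L ∈ latticeFaces (shear '' E), L.p * latticeLength (shear '' E) L =
      ∑ᶠ L ∈ latticeFaces E, (L.p - L.q) * latticeLength E L := by
    rw [← finsum_mem_add_sdiff (Set.sep_subset _ fun L : Line => L.q < L.p) hfin,
      ← image_unshear_latticeFaces, finsum_mem_image Line.unshear_injective.injOn,
      finsum_mem_of_eqOn_zero (s := _ \ _), add_zero]
    · refine finsum_mem_congr rfl fun L hL => ?_
      rw [latticeLength_shear hL]
      simp only [Line.unshear, Nat.add_sub_cancel]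
    · rw [image_unshear_latticeFaces]
      intro L hL
      have : L.p ≤ L.q := not_lt.1 fun h => hL.2 ⟨hL.1, h⟩
      simp [Nat.sub_eq_zero_of_le this]
  have hsplit : ∑ᶠ L ∈ latticeFaces E, L.p * latticeLength E L =
      ∑ᶠ L ∈ latticeFaces E, min L.p L.q * latticeLength E L +
        ∑ᶠ L ∈ latticeFaces E, (L.p - L.q) * latticeLength E L := by
    rw [← finsum_mem_add_distrib hfin]
    refine finsum_mem_congr rfl fun L _ => ?_
    rw [← add_mul]
    congr 1
    omega
  have := finsum_p_mul_latticeLength hE hm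
  omega

end LatticePoints

/-! ### Exponents of an ideal and faces of its Newton polygon -/

/-- The exponent of the monomial `x^a y^b`. -/
noncomputable def pt (a b : ℕ) : Fin 2 →₀ ℕ :=
  Finsupp.single 0 a + Finsupp.single 1 b

@[simp] theorem pt_zero (a b : ℕ) : pt a b 0 = a := by simp [pt]

@[simp] theorem pt_one (a b : ℕ) : pt a b 1 = b := by simp [pt]

@[simp] theorem pt_eta (n : Fin 2 →₀ ℕ) : pt (n 0) (n 1) = n := by
  ext i; fin_cases i <;> simp

@[simp] theorem pt_inj {a b c d : ℕ} : pt a b = pt c d ↔ a = c ∧ b = d :=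
  ⟨fun h => ⟨by simpa using DFunLike.congr_fun h 0, by simpa using DFunLike.congr_fun h 1⟩,
    fun h => by rw [h.1, h.2]⟩

theorem pt_eq_iff {a b : ℕ} {n : Fin 2 →₀ ℕ} : pt a b = n ↔ a = n 0 ∧ b = n 1 := by
  rw [← pt_eta n, pt_inj]; simp

/-- The support of an ideal as a set of lattice points. -/
def expo (I : Ideal PS) : Set (ℕ × ℕ) :=
  {e | ∃ f ∈ I, coeff (pt e.1 e.2) f ≠ 0}

theorem mem_supp_iff {I : Ideal PS} {n : Fin 2 →₀ ℕ} : n ∈ supp I ↔ (n 0, n 1) ∈ expo I := by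
  simp [supp, expo]

section Convexity

variable {𝕜 V : Type*} [Field 𝕜] [LinearOrder 𝕜] [IsStrictOrderedRing 𝕜] [AddCommGroup V]
  [Module 𝕜 V]

theorem convex_setOf_lt_or_mem {f : V →ₗ[𝕜] 𝕜} {N : 𝕜} {C : Set V} (hC : Convex 𝕜 C)
    (hCN : ∀ x ∈ C, N ≤ f x) : Convex 𝕜 {x | N < f x ∨ x ∈ C} := by
  rw [convex_iff_forall_pos]
  intro x hx y hy a b ha hb hab
  have hle : ∀ z ∈ {x | N < f x ∨ x ∈ C}, N ≤ f z := fun z hz => hz.elim le_of_lt (hCN z)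
  by_cases h : x ∈ C ∧ y ∈ C
  · exact Or.inr (hC h.1 h.2 ha.le hb.le hab)
  · have hlt : N < f x ∨ N < f y := by
      rcases hx with hx | hx
      · exact Or.inl hx
      · exact Or.inr (hy.resolve_right fun hy => h ⟨hx, hy⟩)
    left
    calc N = a * N + b * N := by rw [← add_mul, hab, one_mul]
      _ < a * f x + b * f y := by
        rcases hlt with hlt | hlt
        · exact add_lt_add_of_lt_of_le (mul_lt_mul_of_pos_left hlt ha)
            (mul_le_mul_of_nonneg_left (hle y hy) hb.le)
        · exact add_lt_add_of_le_of_lt (mul_le_mul_of_nonneg_left (hle x hx) ha.le)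
            (mul_lt_mul_of_pos_left hlt hb)
      _ = f (a • x + b • y) := by simp

theorem mem_convexHull_sep {f : V →ₗ[𝕜] 𝕜} {N : 𝕜} {S : Set V} (hS : ∀ x ∈ S, N ≤ f x) {x : V}
    (hx : x ∈ convexHull 𝕜 S) (hxN : f x = N) : x ∈ convexHull 𝕜 {y ∈ S | f y = N} := by
  have hsub : convexHull 𝕜 S ⊆ {x | N < f x ∨ x ∈ convexHull 𝕜 {y ∈ S | f y = N}} := by
    refine convexHull_min (fun y hy => ?_) (convex_setOf_lt_or_mem (convex_convexHull 𝕜 _) ?_)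
    · exact (hS y hy).lt_or_eq.imp_right fun h => subset_convexHull 𝕜 _ ⟨hy, h.symm⟩
    · exact fun y hy => convexHull_min (fun z hz => hz.2.ge) (convex_halfSpace_ge f.isLinear N) hy
  exact (hsub hx).resolve_left hxN.not_gt

end Convexity

/-- The linear form of the line `L` on the real plane. -/
noncomputable def Line.form (L : Line) : ℝ × ℝ →ₗ[ℝ] ℝ :=
  (L.p : ℝ) • LinearMap.fst ℝ ℝ ℝ + (L.q : ℝ) • LinearMap.snd ℝ ℝ ℝ

theorem Line.form_apply (L : Line) (P : ℝ × ℝ) : L.form P = L.p * P.1 + L.q * P.2 := rfl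

section Diagram

variable {I : Ideal PS} {L : Line}

theorem mem_diagram {e : ℕ × ℕ} (he : e ∈ expo I) : ((e.1 : ℝ), (e.2 : ℝ)) ∈ diagram (supp I) :=
  subset_convexHull _ _ ⟨pt e.1 e.2, mem_supp_iff.2 (by simpa using he), 0, by simp⟩

theorem forall_mem_diagram_iff :
    (∀ P ∈ diagram (supp I), (L.N : ℝ) ≤ L.p * P.1 + L.q * P.2) ↔
      ∀ e ∈ expo I, L.N ≤ L.p * e.1 + L.q * e.2 := by
  constructor
  · intro h e he
    have hLe := h _ (mem_diagram he)
    dsimp only at hLe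
    exact_mod_cast hLe
  · refine fun h P hP => convexHull_min (t := {P | (L.N : ℝ) ≤ L.form P}) ?_
      (convex_halfSpace_ge L.form.isLinear _) hP
    rintro _ ⟨n, hn, b, hb, hc, rfl⟩
    have h1 : (L.N : ℝ) ≤ L.p * n 0 + L.q * n 1 := by exact_mod_cast h _ (mem_supp_iff.1 hn)
    simp only [Set.mem_ofPred_eq, Line.form_apply]
    nlinarith [mul_nonneg (Nat.cast_nonneg (α := ℝ) L.p) hb,
      mul_nonneg (Nat.cast_nonneg (α := ℝ) L.q) hc]

theorem diagram_sep_subset (hp : 0 < L.p) (hq : 0 < L.q)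
    (hle : ∀ e ∈ expo I, L.N ≤ L.p * e.1 + L.q * e.2) :
    {P ∈ diagram (supp I) | (L.p : ℝ) * P.1 + L.q * P.2 = L.N} ⊆
      convexHull ℝ (Prod.map (↑) (↑) '' edge (expo I) L) := by
  rintro P ⟨hP, hPN⟩
  have hmin := forall_mem_diagram_iff.2 hle
  refine convexHull_mono ?_ (mem_convexHull_sep (f := L.form)
    (fun x hx => hmin x (subset_convexHull ℝ _ hx)) hP hPN)
  rintro _ ⟨⟨n, hn, b, hb, hc, rfl⟩, hN⟩
  have h1 : (L.N : ℝ) ≤ L.p * n 0 + L.q * n 1 := by exact_mod_cast hle _ (mem_supp_iff.1 hn)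
  have hp' : (0 : ℝ) < L.p := by exact_mod_cast hp
  have hq' : (0 : ℝ) < L.q := by exact_mod_cast hq
  simp only [Line.form_apply] at hN
  have hb' := mul_nonneg hp'.le hb
  have hc' := mul_nonneg hq'.le hc
  have hb0 : b.1 = 0 := (mul_eq_zero.1 (by linarith : (L.p : ℝ) * b.1 = 0)).resolve_left hp'.ne'
  have hc0 : b.2 = 0 := (mul_eq_zero.1 (by linarith : (L.q : ℝ) * b.2 = 0)).resolve_left hq'.ne'
  rw [hb0, hc0, add_zero, add_zero] at hN ⊢
  exact ⟨(n 0, n 1), ⟨mem_supp_iff.1 hn, by exact_mod_cast hN⟩, rfl⟩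

theorem nontrivial_diagram_sep_iff (hp : 0 < L.p) (hq : 0 < L.q)
    (hle : ∀ e ∈ expo I, L.N ≤ L.p * e.1 + L.q * e.2) :
    {P ∈ diagram (supp I) | (L.p : ℝ) * P.1 + L.q * P.2 = L.N}.Nontrivial ↔
      (edge (expo I) L).Nontrivial := by
  have hinj : Function.Injective (Prod.map (↑) (↑) : ℕ × ℕ → ℝ × ℝ) :=
    Nat.cast_injective.prodMap Nat.cast_injective
  constructor
  · contrapose!
    intro h
    have hsub := h.image (Prod.map (↑) (↑) : ℕ × ℕ → ℝ × ℝ)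
    have := diagram_sep_subset hp hq hle
    rw [hsub.convex.convexHull_eq] at this
    exact hsub.anti this
  · intro h
    refine ((Set.image_nontrivial hinj).2 h).mono ?_
    rintro _ ⟨e, he, rfl⟩
    refine ⟨mem_diagram he.1, ?_⟩
    simp only [Prod.map_fst, Prod.map_snd]
    exact_mod_cast he.2

theorem isFace_iff : IsFace I L ↔ IsLatticeFace (expo I) L := by
  constructor
  · rintro ⟨hp, hq, hc, hle, hnt⟩
    have hle' := forall_mem_diagram_iff.1 hle
    exact ⟨hp, hq, hc, hle', (nontrivial_diagram_sep_iff hp hq hle').1 hnt⟩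
  · rintro ⟨hp, hq, hc, hle, hnt⟩
    exact ⟨hp, hq, hc, forall_mem_diagram_iff.2 hle, (nontrivial_diagram_sep_iff hp hq hle).2 hnt⟩

end Diagram

/-! ### Initial parts -/

/-- The ideal of the power series whose coefficients at the exponents of a lower set vanish. -/
def vanishingIdeal {σ R : Type*} [CommSemiring R] {U : Set (σ →₀ ℕ)} (hU : IsLowerSet U) :
    Ideal (MvPowerSeries σ R) where
  carrier := {f | ∀ n ∈ U, coeff n f = 0}
  zero_mem' := fun n _ => by simp
  add_mem' := fun {f g} hf hg n hn => by rw [map_add, hf n hn, hg n hn, add_zero]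
  smul_mem' := fun r f hf n hn => by
    classical
    rw [smul_eq_mul, coeff_mul]
    refine Finset.sum_eq_zero fun x hx => ?_
    rw [hf x.2 (hU (Finset.HasAntidiagonal.mem_antidiagonal.1 hx ▸ le_add_self) hn), mul_zero]

theorem isLowerSet_weight_lt (p q N : ℕ) : IsLowerSet {n : Fin 2 →₀ ℕ | p * n 0 + q * n 1 < N} :=
  fun a b hba (ha : p * a 0 + q * a 1 < N) => by
    have h0 := Nat.mul_le_mul_left p (hba 0)
    have h1 := Nat.mul_le_mul_left q (hba 1)
    change p * b 0 + q * b 1 < N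
    omega

section InitialPart

variable {I : Ideal PS} {L : Line} {f g : PS} {S : Set PS}

theorem coeff_initialPart (L : Line) (f : PS) (n : Fin 2 →₀ ℕ) :
    coeff n (initialPart L f) = if L.p * n 0 + L.q * n 1 = L.N then coeff n f else 0 := rfl

/-- The initial part as a linear map. -/
noncomputable def initialPartₗ (L : Line) : PS →ₗ[ℂ] PS where
  toFun := initialPart L
  map_add' f g := by ext n; simp only [coeff_initialPart, map_add]; split_ifs <;> simp
  map_smul' c f := by ext n; simp [coeff_initialPart]

@[simp] theorem initialPartₗ_apply (L : Line) (f : PS) : initialPartₗ L f = initialPart L f := rfl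

theorem initialPart_mul (hp : 0 < L.p) (hq : 0 < L.q) (r : PS)
    (hg : ∀ n, L.p * n 0 + L.q * n 1 < L.N → coeff n g = 0) :
    initialPart L (r * g) = constantCoeff r • initialPart L g := by
  classical
  ext n
  simp only [coeff_initialPart, coeff_smul]
  split_ifs with hn
  · rw [coeff_mul, Finset.sum_eq_single (0, n)]
    · simp
    · rintro ⟨x, y⟩ hxy hne
      obtain rfl : x + y = n := Finset.HasAntidiagonal.mem_antidiagonal.1 hxy
      have hx : x 0 ≠ 0 ∨ x 1 ≠ 0 := by
        by_contra! hx
        obtain rfl : x = 0 := by ext i; fin_cases i <;> simp [hx]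
        simp at hne
      rw [hg y, mul_zero]
      simp only [Finsupp.add_apply] at hn
      rcases hx with hx | hx
      · nlinarith [Nat.mul_pos hp (Nat.pos_of_ne_zero hx)]
      · nlinarith [Nat.mul_pos hq (Nat.pos_of_ne_zero hx)]
    · simp
  · simp

/-- The power series supported on the line `L`. -/
def IsOnLine (L : Line) (f : PS) : Prop :=
  ∀ n, L.p * n 0 + L.q * n 1 ≠ L.N → coeff n f = 0

theorem IsOnLine.initialPart_eq (h : IsOnLine L f) : initialPart L f = f := by
  ext n
  rw [coeff_initialPart]
  split_ifs with hn
  · rfl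
  · rw [h n hn]

theorem isOnLine_initialPart (L : Line) (f : PS) : IsOnLine L (initialPart L f) := fun n hn => by
  rw [coeff_initialPart, if_neg hn]

theorem coeff_eq_zero_of_mem_span (hS : ∀ s ∈ S, IsOnLine L s) (hg : g ∈ Ideal.span S)
    {n : Fin 2 →₀ ℕ} (hn : L.p * n 0 + L.q * n 1 < L.N) : coeff n g = 0 :=
  (Ideal.span_le (I := vanishingIdeal (isLowerSet_weight_lt L.p L.q L.N))).2
    (fun s hs _ hn => hS s hs _ (ne_of_lt hn)) hg n hn

theorem initialPart_mem_span (hp : 0 < L.p) (hq : 0 < L.q) (hS : ∀ s ∈ S, IsOnLine L s)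
    (hg : g ∈ Ideal.span S) : initialPart L g ∈ Submodule.span ℂ S := by
  induction hg using Submodule.span_induction with
  | mem x hx =>
    rw [(hS x hx).initialPart_eq]
    exact Submodule.subset_span hx
  | zero =>
    rw [← initialPartₗ_apply, map_zero]
    exact zero_mem _
  | add x y hx hy ihx ihy =>
    rw [← initialPartₗ_apply, map_add]
    exact add_mem ihx ihy
  | smul r x hx ih =>
    rw [smul_eq_mul, initialPart_mul hp hq r fun n hn => coeff_eq_zero_of_mem_span hS hx hn]
    exact Submodule.smul_mem _ _ ih

/-- The space of the initial parts of the elements of `I`. -/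
noncomputable def initialSpace (I : Ideal PS) (L : Line) : Submodule ℂ PS :=
  (I.restrictScalars ℂ).map (initialPartₗ L)

theorem initialIdeal_eq_span (I : Ideal PS) (L : Line) :
    initialIdeal I L = Ideal.span (initialSpace I L : Set PS) := rfl

theorem isOnLine_of_mem_initialSpace (hg : g ∈ initialSpace I L) : IsOnLine L g := by
  obtain ⟨f, -, rfl⟩ := hg
  exact isOnLine_initialPart L f

theorem initialSpace_eq_span (hp : 0 < L.p) (hq : 0 < L.q) (hS : ∀ s ∈ S, IsOnLine L s)
    (h : initialIdeal I L = Ideal.span S) : initialSpace I L = Submodule.span ℂ S := by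
  rw [initialIdeal_eq_span] at h
  apply le_antisymm
  · intro v hv
    have h1 : v ∈ Ideal.span S := h ▸ Ideal.subset_span hv
    have h2 := initialPart_mem_span hp hq hS h1
    rwa [(isOnLine_of_mem_initialSpace hv).initialPart_eq] at h2
  · rw [Submodule.span_le]
    intro s hs
    have h1 : s ∈ Ideal.span (initialSpace I L : Set PS) := h ▸ Ideal.subset_span hs
    have h2 := initialPart_mem_span hp hq (fun _ => isOnLine_of_mem_initialSpace) h1
    rwa [(hS s hs).initialPart_eq, Submodule.span_eq] at h2

end InitialPart

/-! ### Binary forms -/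

section Homogeneous

variable {R : Type*} [CommSemiring R]

/-- Dehomogenization of binary forms: the polynomial `F(1, t)`. -/
noncomputable def dehom : MvPolynomial (Fin 2) R →ₐ[R] Polynomial R :=
  MvPolynomial.aeval ![1, Polynomial.X]

/-- The homogeneous polynomial `F` of degree `D` with `F(1, t) = w`. The swap is needed because
`Polynomial.homogenize` takes the second variable as the homogenizing one. -/
noncomputable def homog (D : ℕ) (w : Polynomial R) : MvPolynomial (Fin 2) R :=
  MvPolynomial.rename (Equiv.swap 0 1) (w.homogenize D)

variable {D m n i j : ℕ} {F : MvPolynomial (Fin 2) R} {v w : Polynomial R}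

theorem homog_isHomogeneous (D : ℕ) (w : Polynomial R) : (homog D w).IsHomogeneous D :=
  (Polynomial.isHomogeneous_homogenize w).rename_isHomogeneous

theorem dehom_homog (hw : w.natDegree ≤ D) : dehom (homog D w) = w := by
  rw [dehom, homog, MvPolynomial.aeval_rename, Polynomial.aeval_homogenize_of_eq_one hw _ (by simp)]
  simp

theorem homog_dehom (hF : F.IsHomogeneous D) : homog D (dehom F) = F := by
  have hswap : MvPolynomial.aeval ![Polynomial.X, 1]
      (MvPolynomial.rename (Equiv.swap 0 1) F) = dehom F := by
    rw [dehom, MvPolynomial.aeval_rename]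
    congr 2
    ext i; fin_cases i <;> simp
  rw [homog, Polynomial.homogenize_eq_of_isHomogeneous hF.rename_isHomogeneous hswap,
    MvPolynomial.rename_rename, ← Equiv.coe_trans, Equiv.swap_swap]
  simp

theorem homog_mul (hv : v.natDegree ≤ m) (hw : w.natDegree ≤ n) :
    homog (m + n) (v * w) = homog m v * homog n w := by
  simp only [homog, Polynomial.homogenize_mul _ _ hv hw, map_mul]

theorem homog_one (D : ℕ) : homog D (1 : Polynomial R) = MvPolynomial.X 0 ^ D := by
  simp [homog]

theorem homog_eq_sum (D : ℕ) (w : Polynomial R) :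
    homog D w = ∑ j ∈ Finset.range (D + 1), MvPolynomial.monomial (pt (D - j) j) (w.coeff j) := by
  rw [homog, Polynomial.homogenize, map_sum, Finset.Nat.sum_antidiagonal_eq_sum_range_succ_mk]
  refine Finset.sum_congr rfl fun j _ => ?_
  rw [MvPolynomial.rename_monomial]
  refine congrArg (MvPolynomial.monomial · _) (pt_eq_iff.2 ⟨?_, ?_⟩).symm <;>
  · rw [Finsupp.mapDomain_equiv_apply]; simp

theorem coeff_homog (hj : j ≤ D) (w : Polynomial R) :
    (homog D w).coeff (pt (D - j) j) = w.coeff j := by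
  rw [homog_eq_sum, MvPolynomial.coeff_sum, Finset.sum_eq_single j]
  · simp
  · intro i _ hi
    rw [MvPolynomial.coeff_monomial, if_neg]
    exact fun h => hi (pt_inj.1 h).2
  · exact fun h => absurd (Finset.mem_range_succ_iff.2 hj) h

theorem coeff_dehom (hF : F.IsHomogeneous D) (hj : j ≤ D) :
    (dehom F).coeff j = F.coeff (pt (D - j) j) := by
  rw [← coeff_homog hj, homog_dehom hF]

theorem coeff_eq_zero_of_isHomogeneous (hF : F.IsHomogeneous D) {n : Fin 2 →₀ ℕ}
    (hn : n 0 + n 1 ≠ D) : F.coeff n = 0 :=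
  hF.coeff_eq_zero (by rwa [Finsupp.degree_eq_sum, Fin.sum_univ_two])

theorem natDegree_dehom_le (hF : F.IsHomogeneous D) : (dehom F).natDegree ≤ D := by
  rw [F.as_sum, map_sum]
  refine Polynomial.natDegree_sum_le_of_forall_le _ _ fun n hn => ?_
  have hnD : n 0 + n 1 = D :=
    not_imp_comm.1 (coeff_eq_zero_of_isHomogeneous hF) (MvPolynomial.mem_support_iff.1 hn)
  have hmon : dehom (MvPolynomial.monomial n (F.coeff n)) =
      Polynomial.C (F.coeff n) * Polynomial.X ^ n 1 := by
    simp [dehom, MvPolynomial.aeval_monomial, Finsupp.prod_fintype, Polynomial.C_eq_algebraMap]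
  rw [hmon]
  exact (Polynomial.natDegree_C_mul_X_pow_le _ _).trans (by omega)

theorem eval_dehom (F : MvPolynomial (Fin 2) R) (μ : R) :
    (dehom F).eval μ = MvPolynomial.eval ![1, μ] F := by
  have h : (Polynomial.aeval μ).comp dehom = MvPolynomial.aeval (R := R) ![1, μ] := by
    ext i; fin_cases i <;> simp [dehom]
  simpa [Polynomial.coe_aeval_eq_eval, MvPolynomial.coe_aeval_eq_eval] using DFunLike.congr_fun h F

theorem X_dvd_iff_forall_coeff_eq_zero {σ : Type*} {i : σ} {F : MvPolynomial σ R} :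
    MvPolynomial.X i ∣ F ↔ ∀ n : σ →₀ ℕ, n i = 0 → F.coeff n = 0 := by
  classical
  constructor
  · rintro ⟨G, rfl⟩ n hn
    rw [mul_comm, MvPolynomial.coeff_mul_X', if_neg (by simpa using hn)]
  · intro h
    rw [F.as_sum]
    refine Finset.dvd_sum fun n hn => MvPolynomial.X_dvd_monomial.2 (Or.inr fun h0 => ?_)
    exact MvPolynomial.mem_support_iff.1 hn (h n h0)

theorem X_zero_dvd_iff (hF : F.IsHomogeneous D) :
    MvPolynomial.X 0 ∣ F ↔ (dehom F).coeff D = 0 := by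
  rw [coeff_dehom hF le_rfl, X_dvd_iff_forall_coeff_eq_zero]
  refine ⟨fun h => h _ (by simp), fun h n hn => ?_⟩
  by_cases h1 : n 1 = D
  · rw [← h, tsub_self, ← pt_eta n, hn, h1]
  · exact coeff_eq_zero_of_isHomogeneous hF (by omega)

theorem X_one_dvd_iff (hF : F.IsHomogeneous D) :
    MvPolynomial.X 1 ∣ F ↔ (dehom F).coeff 0 = 0 := by
  rw [coeff_dehom hF (Nat.zero_le _), X_dvd_iff_forall_coeff_eq_zero]
  refine ⟨fun h => h _ (by simp), fun h n hn => ?_⟩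
  by_cases h1 : n 0 = D
  · rw [← h, tsub_zero, ← pt_eta n, hn, h1]
  · exact coeff_eq_zero_of_isHomogeneous hF (by omega)

theorem coeff_dehom_eq_one (hF : F.IsHomogeneous D) (hD : F.coeff (Finsupp.single 1 D) = 1) :
    (dehom F).coeff D = 1 := by
  rw [coeff_dehom hF le_rfl, ← hD]
  congr 1
  rw [pt_eq_iff]; simp

theorem monic_dehom (hF : F.IsHomogeneous D) (hD : F.coeff (Finsupp.single 1 D) = 1) :
    (dehom F).Monic :=
  Polynomial.monic_of_natDegree_le_of_coeff_eq_one D (natDegree_dehom_le hF)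
    (coeff_dehom_eq_one hF hD)

theorem natDegree_dehom [Nontrivial R] (hF : F.IsHomogeneous D)
    (hD : F.coeff (Finsupp.single 1 D) = 1) : (dehom F).natDegree = D :=
  Polynomial.natDegree_eq_of_le_of_coeff_ne_zero (natDegree_dehom_le hF)
    (by rw [coeff_dehom_eq_one hF hD]; exact one_ne_zero)

end Homogeneous

section CoprimeForms

variable {R ι : Type*} [CommRing R] {d : ℕ}

theorem dvd_X_pow_of_dvd_homog {κ : ι → Polynomial R} (hκ : ∀ i, (κ i).natDegree ≤ d)
    (h1 : Ideal.span (Set.range κ) = ⊤) {g : MvPolynomial (Fin 2) R}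
    (hg : ∀ i, g ∣ homog d (κ i)) : ∃ r, g ∣ MvPolynomial.X 0 ^ r := by
  obtain ⟨c, hc⟩ := Finsupp.mem_span_range_iff_exists_finsupp.1
    (h1 ▸ Submodule.mem_top : (1 : Polynomial R) ∈ Ideal.span (Set.range κ))
  set r := c.support.sup fun i => (c i).natDegree
  refine ⟨r + d, ?_⟩
  rw [← homog_one, ← hc, Finsupp.sum, homog, Polynomial.homogenize_finsetSum, map_sum]
  refine Finset.dvd_sum fun i hi => ?_
  change g ∣ homog (r + d) (c i * κ i)
  rw [homog_mul (Finset.le_sup (f := fun i => (c i).natDegree) hi) (hκ i)]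
  exact (hg i).mul_left _

variable [IsDomain R] {κ : ι → MvPolynomial (Fin 2) R}

theorem homog_X_sub_C_dvd {w : Polynomial R} (hw : w.natDegree ≤ d) {μ : R}
    (h : w.eval μ = 0) : homog 1 (Polynomial.X - Polynomial.C μ) ∣ homog d w := by
  obtain ⟨u, rfl⟩ := Polynomial.dvd_iff_isRoot.2 h
  by_cases hu : u = 0
  · simp [hu, homog]
  · rw [Polynomial.natDegree_mul (Polynomial.X_sub_C_ne_zero μ) hu,
      Polynomial.natDegree_X_sub_C] at hw
    obtain ⟨e, rfl⟩ := Nat.exists_eq_add_of_le hw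
    rw [add_assoc, homog_mul (by simp) (by omega)]
    exact Dvd.intro _ rfl

theorem exists_eval_dehom_ne_zero (hκ : ∀ i, (κ i).IsHomogeneous d)
    (hcop : ∀ g, (∀ i, g ∣ κ i) → IsUnit g) (μ : R) : ∃ i, (dehom (κ i)).eval μ ≠ 0 := by
  by_contra! hcon
  have hunit : IsUnit (homog 1 (Polynomial.X - Polynomial.C μ)) := hcop _ fun i => by
    rw [← homog_dehom (hκ i)]
    exact homog_X_sub_C_dvd (natDegree_dehom_le (hκ i)) (hcon i)
  have hunit' := hunit.map dehom
  rw [dehom_homog (by simp)] at hunit'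
  exact Polynomial.not_isUnit_X_sub_C μ hunit'

theorem exists_coeff_dehom_ne_zero (hκ : ∀ i, (κ i).IsHomogeneous d)
    (hcop : ∀ g, (∀ i, g ∣ κ i) → IsUnit g) : ∃ i, (dehom (κ i)).coeff d ≠ 0 := by
  by_contra! hcon
  exact MvPolynomial.X_prime.not_isUnit (hcop (MvPolynomial.X 0) fun i =>
    (X_zero_dvd_iff (hκ i)).2 (hcon i))

theorem isUnit_of_dvd_homog {κ : ι → Polynomial R} (hκ : ∀ i, (κ i).natDegree ≤ d)
    (htop : ∃ i, (κ i).coeff d ≠ 0) (h1 : Ideal.span (Set.range κ) = ⊤)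
    {g : MvPolynomial (Fin 2) R} (hg : ∀ i, g ∣ homog d (κ i)) : IsUnit g := by
  obtain ⟨r, hr⟩ := dvd_X_pow_of_dvd_homog hκ h1 hg
  obtain ⟨j, -, hj⟩ := (dvd_prime_pow MvPolynomial.X_prime _).1 hr
  rcases Nat.eq_zero_or_pos j with rfl | hj0
  · rw [pow_zero] at hj
    exact hj.symm.isUnit isUnit_one
  · obtain ⟨i, hi⟩ := htop
    have hX : MvPolynomial.X 0 ∣ homog d (κ i) :=
      ((dvd_pow_self _ hj0.ne').trans hj.symm.dvd).trans (hg i)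
    rw [X_zero_dvd_iff (homog_isHomogeneous _ _), dehom_homog (hκ i)] at hX
    exact absurd hX hi

end CoprimeForms

/-! ### Power series on a line -/

section LineSeries

variable {a b p q D j : ℕ} {w : Polynomial ℂ}

/-- The power series `x^a y^b W(x^q, y^p)`, where `W` is homogeneous of degree `D` and
`W(1, t) = w`. -/
noncomputable def lineSeries (a b p q D : ℕ) : Polynomial ℂ →ₗ[ℂ] PS :=
  ∑ j ∈ Finset.range (D + 1),
    (monomial (pt (a + q * (D - j)) (b + p * j))).comp (Polynomial.lcoeff ℂ j)

theorem lineSeries_apply (a b p q D : ℕ) (w : Polynomial ℂ) :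
    lineSeries a b p q D w =
      ∑ j ∈ Finset.range (D + 1), monomial (pt (a + q * (D - j)) (b + p * j)) (w.coeff j) := by
  simp [lineSeries]

theorem coeff_lineSeries (hp : 0 < p) (hj : j ≤ D) (w : Polynomial ℂ) :
    coeff (pt (a + q * (D - j)) (b + p * j)) (lineSeries a b p q D w) = w.coeff j := by
  classical
  rw [lineSeries_apply, map_sum, Finset.sum_eq_single j]
  · simp
  · intro i _ hi
    rw [coeff_monomial, if_neg]
    rw [pt_inj]
    rintro ⟨-, h⟩
    exact hi (Nat.eq_of_mul_eq_mul_left hp (Nat.add_left_cancel h)).symm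
  · exact fun h => absurd (Finset.mem_range_succ_iff.2 hj) h

theorem exists_of_coeff_lineSeries_ne_zero {n : Fin 2 →₀ ℕ}
    (h : coeff n (lineSeries a b p q D w) ≠ 0) :
    ∃ j ≤ D, n = pt (a + q * (D - j)) (b + p * j) := by
  classical
  rw [lineSeries_apply, map_sum] at h
  obtain ⟨j, hj, hne⟩ := Finset.exists_ne_zero_of_sum_ne_zero h
  rw [coeff_monomial] at hne
  exact ⟨j, Finset.mem_range_succ_iff.1 hj, by_contra fun h' => hne (if_neg h')⟩

theorem lineSeries_ne_zero (hp : 0 < p) (hw : w.natDegree ≤ D) (h0 : w ≠ 0) :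
    lineSeries a b p q D w ≠ 0 := by
  intro h
  refine h0 (Polynomial.leadingCoeff_eq_zero.1 ?_)
  rw [Polynomial.leadingCoeff, ← coeff_lineSeries (a := a) (b := b) (q := q) hp hw w, h, map_zero]

theorem weight_lineSeries (hj : j ≤ D) :
    p * (a + q * (D - j)) + q * (b + p * j) = p * a + q * b + p * q * D := by
  obtain ⟨i, rfl⟩ := Nat.exists_eq_add_of_le hj
  rw [Nat.add_sub_cancel_left]; ring

theorem isOnLine_lineSeries (a b p q D : ℕ) (w : Polynomial ℂ) :
    IsOnLine ⟨p, q, p * a + q * b + p * q * D⟩ (lineSeries a b p q D w) := by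
  intro n hn
  by_contra h
  obtain ⟨j, hj, rfl⟩ := exists_of_coeff_lineSeries_ne_zero h
  exact hn (by simpa using weight_lineSeries hj)

theorem monomial_pt (a b : ℕ) (c : ℂ) :
    (monomial (pt a b) c : PS) = C c * (X 0 ^ a * X 1 ^ b) := by
  rw [X_pow_eq, X_pow_eq, monomial_mul_monomial, mul_one, ← monomial_zero_eq_C_apply,
    monomial_mul_monomial, mul_one, zero_add, pt]

theorem mul_aeval_eq_lineSeries {F : MvPolynomial (Fin 2) ℂ} (hF : F.IsHomogeneous D)
    (a b p q : ℕ) :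
    (X 0 : PS) ^ a * X 1 ^ b * MvPolynomial.aeval ![(X 0 : PS) ^ q, X 1 ^ p] F =
      lineSeries a b p q D (dehom F) := by
  conv_lhs => rw [← homog_dehom hF, homog_eq_sum, map_sum, Finset.mul_sum]
  rw [lineSeries_apply]
  refine Finset.sum_congr rfl fun j _ => ?_
  have halg : algebraMap ℂ PS ((dehom F).coeff j) = C ((dehom F).coeff j) := rfl
  rw [MvPolynomial.aeval_monomial, monomial_pt, halg]
  simp only [Finsupp.prod_fintype, pow_zero, implies_true, Fin.prod_univ_two, pt_zero, pt_one,
    Matrix.cons_val_zero, Matrix.cons_val_one]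
  ring

end LineSeries

/-! ### Normal forms of the spaces of initial parts -/

section NormalForm

variable {I : Ideal PS} {L : Line} {a b d D : ℕ} {f : PS} {F : MvPolynomial (Fin 2) ℂ}
  {G : Polynomial ℂ} {W : Submodule ℂ (Polynomial ℂ)}

theorem mem_edge_expo_iff {e : ℕ × ℕ} :
    e ∈ edge (expo I) L ↔ ∃ g ∈ initialSpace I L, coeff (pt e.1 e.2) g ≠ 0 := by
  constructor
  · rintro ⟨⟨f, hf, hfe⟩, he⟩
    exact ⟨_, ⟨f, hf, rfl⟩, by simpa [coeff_initialPart, he] using hfe⟩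
  · rintro ⟨_, ⟨f, hf, rfl⟩, h⟩
    simp only [initialPartₗ_apply, coeff_initialPart, pt_zero, pt_one, ne_eq, ite_eq_right_iff,
      Classical.not_imp] at h
    exact ⟨⟨f, hf, h.2⟩, h.1⟩

theorem IsOnLine.le_of_mem_span {p q N N' : ℕ} {S : Set PS} (hS : ∀ s ∈ S, IsOnLine ⟨p, q, N⟩ s)
    (hf : f ∈ Ideal.span S) (hf0 : f ≠ 0) (hfN : IsOnLine ⟨p, q, N'⟩ f) : N ≤ N' := by
  by_contra! hlt
  refine hf0 (ext fun n => ?_)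
  by_cases hn : p * n 0 + q * n 1 = N'
  · exact coeff_eq_zero_of_mem_span hS hf (hn.trans_lt hlt)
  · exact hfN n hn

theorem N_eq_of_initialIdeal_eq_span {N : ℕ} {S : Set PS}
    (hS : ∀ s ∈ S, IsOnLine ⟨L.p, L.q, N⟩ s) (h : initialIdeal I L = Ideal.span S)
    (hf : f ∈ S) (hf0 : f ≠ 0) : L.N = N := by
  rw [initialIdeal_eq_span] at h
  have hf' : f ∈ Ideal.span (initialSpace I L : Set PS) := h ▸ Ideal.subset_span hf
  have hinit : ∀ g ∈ (initialSpace I L : Set PS), IsOnLine L g := fun _ =>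
    isOnLine_of_mem_initialSpace
  refine le_antisymm (IsOnLine.le_of_mem_span hinit hf' hf0 (hS f hf)) ?_
  obtain ⟨g, hg, hg0⟩ : ∃ g ∈ initialSpace I L, g ≠ 0 := by
    by_contra! hzero
    exact hf0 (by simpa using Ideal.span_mono (t := {0}) hzero hf')
  exact IsOnLine.le_of_mem_span hS (h ▸ Ideal.subset_span hg) hg0 (hinit g hg)

theorem natDegree_le_of_mem_span {R : Type*} [CommSemiring R] {S : Set (Polynomial R)}
    (hS : ∀ w ∈ S, w.natDegree ≤ d) {w : Polynomial R} (hw : w ∈ Submodule.span R S) :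
    w.natDegree ≤ d := by
  have hle : Submodule.span R S ≤ Polynomial.degreeLE R d := Submodule.span_le.2 fun v hv =>
    Polynomial.mem_degreeLE.2 (Polynomial.degree_le_of_natDegree_le (hS v hv))
  exact Polynomial.natDegree_le_of_degree_le (Polynomial.mem_degreeLE.1 (hle hw))

/-- A description of the space of initial parts along `L`: it consists of the series
`x^a y^b (G w)(x^q, y^p)`, where `w` runs through a space `W` of polynomials of degree at most `d`
without common root, and `G w` is homogenized in degree `deg G + d`. Here `G = F(1, t)` for the face
polynomial `F`, and `W` is spanned by the `k_i(1, t)`. -/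
structure IsNormalForm (I : Ideal PS) (L : Line) (a b d : ℕ) (G : Polynomial ℂ)
    (W : Submodule ℂ (Polynomial ℂ)) : Prop where
  monic : G.Monic
  coeff_zero : G.coeff 0 ≠ 0
  natDegree_le : ∀ w ∈ W, w.natDegree ≤ d
  exists_eval_ne_zero : ∀ μ : ℂ, ∃ w ∈ W, w.eval μ ≠ 0
  exists_coeff_ne_zero : ∃ w ∈ W, w.coeff d ≠ 0
  weight_eq : L.N = L.p * a + L.q * b + L.p * L.q * (G.natDegree + d)
  initialSpace_eq : initialSpace I L =
    W.map (lineSeries a b L.p L.q (G.natDegree + d) ∘ₗ LinearMap.mulLeft ℂ G)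

theorem IsNormalForm.lineSeries_mem (h : IsNormalForm I L a b d G W) {w : Polynomial ℂ}
    (hw : w ∈ W) : lineSeries a b L.p L.q (G.natDegree + d) (G * w) ∈ initialSpace I L := by
  rw [h.initialSpace_eq]
  exact ⟨w, hw, rfl⟩

theorem IsNormalForm.isSegment (hp : 0 < L.p) (h : IsNormalForm I L a b d G W) :
    IsSegment (expo I) L a b (G.natDegree + d) where
  top_mem := by
    obtain ⟨w, hw, hwd⟩ := h.exists_coeff_ne_zero
    refine mem_edge_expo_iff.2 ⟨_, h.lineSeries_mem hw, ?_⟩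
    have hcoeff := coeff_lineSeries (a := a) (b := b) (q := L.q) hp
      (le_refl (G.natDegree + d)) (G * w)
    rw [tsub_self, mul_zero, add_zero, Polynomial.coeff_mul_add_eq_of_natDegree_le le_rfl
      (h.natDegree_le w hw), h.monic.coeff_natDegree, one_mul] at hcoeff
    exact hcoeff ▸ hwd
  bot_mem := by
    obtain ⟨w, hw, hw0⟩ := h.exists_eval_ne_zero 0
    refine mem_edge_expo_iff.2 ⟨_, h.lineSeries_mem hw, ?_⟩
    have hcoeff := coeff_lineSeries (a := a) (b := b) (q := L.q) hp
      (Nat.zero_le (G.natDegree + d)) (G * w)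
    rw [mul_zero, add_zero, tsub_zero, Polynomial.mul_coeff_zero] at hcoeff
    rw [← Polynomial.coeff_zero_eq_eval_zero] at hw0
    exact hcoeff ▸ mul_ne_zero h.coeff_zero hw0
  exists_eq := fun e he => by
    obtain ⟨g, hg, hge⟩ := mem_edge_expo_iff.1 he
    rw [h.initialSpace_eq] at hg
    obtain ⟨w, -, rfl⟩ := hg
    obtain ⟨j, hj, hej⟩ := exists_of_coeff_lineSeries_ne_zero hge
    exact ⟨j, hj, Prod.ext_iff.2 (pt_inj.1 hej)⟩

theorem IsFaceData.exists_isNormalForm (hp : 0 < L.p) (hq : 0 < L.q) (h : IsFaceData I L F d) :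
    ∃ a b W, IsNormalForm I L a b d (dehom F) W := by
  obtain ⟨⟨n, hF, hF1⟩, -, hX1, a, b, s, k, hk, hcop, hI⟩ := h
  have hdeg : (dehom F).natDegree = n := natDegree_dehom hF hF1
  have hmonic : (dehom F).Monic := monic_dehom hF hF1
  set φ := lineSeries a b L.p L.q (n + d) ∘ₗ LinearMap.mulLeft ℂ (dehom F)
  set S := Set.range fun i => dehom (k i)
  have hspan : initialIdeal I L = Ideal.span (φ '' S) := by
    rw [hI, ← Set.range_comp]
    congr 2
    ext1 i
    rw [mul_assoc, ← map_mul, mul_aeval_eq_lineSeries (hF.mul (hk i)), map_mul]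
    rfl
  have hline : ∀ f ∈ φ '' S, IsOnLine ⟨L.p, L.q, L.p * a + L.q * b + L.p * L.q * (n + d)⟩ f := by
    rintro _ ⟨w, -, rfl⟩
    exact isOnLine_lineSeries _ _ _ _ _ _
  have hN : L.N = L.p * a + L.q * b + L.p * L.q * (n + d) := by
    obtain ⟨i, hi⟩ := exists_eval_dehom_ne_zero hk hcop 0
    have hki : dehom (k i) ≠ 0 := fun h => hi (by rw [h, Polynomial.eval_zero])
    refine N_eq_of_initialIdeal_eq_span hline hspan ⟨_, ⟨i, rfl⟩, rfl⟩
      (lineSeries_ne_zero hp ?_ (mul_ne_zero hmonic.ne_zero hki))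
    change (dehom F * dehom (k i)).natDegree ≤ n + d
    rw [hmonic.natDegree_mul' hki, hdeg]
    exact Nat.add_le_add_left (natDegree_dehom_le (hk i)) n
  refine ⟨a, b, Submodule.span ℂ S, hmonic, fun h0 => hX1 ((X_one_dvd_iff hF).2 h0),
    fun w => natDegree_le_of_mem_span (Set.forall_mem_range.2 fun i => natDegree_dehom_le (hk i)),
    fun μ => ?_, ?_, hdeg ▸ hN, ?_⟩
  · obtain ⟨i, hi⟩ := exists_eval_dehom_ne_zero hk hcop μ
    exact ⟨_, Submodule.subset_span ⟨i, rfl⟩, hi⟩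
  · obtain ⟨i, hi⟩ := exists_coeff_dehom_ne_zero hk hcop
    exact ⟨_, Submodule.subset_span ⟨i, rfl⟩, hi⟩
  · rw [← hN] at hline
    rw [initialSpace_eq_span hp hq hline hspan, Submodule.map_span, hdeg]

end NormalForm

/-! ### Existence of face data -/

section Existence

variable {I : Ideal PS} {L : Line} {a b d D : ℕ}

theorem exists_lineSeries_eq {p q : ℕ} {f : PS} (hp : 0 < p)
    (hf : ∀ n, coeff n f ≠ 0 → ∃ j ≤ D, n = pt (a + q * (D - j)) (b + p * j)) :
    ∃ w : Polynomial ℂ, w.natDegree ≤ D ∧ lineSeries a b p q D w = f := by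
  set w : Polynomial ℂ := ∑ j ∈ Finset.range (D + 1),
    Polynomial.monomial j (coeff (pt (a + q * (D - j)) (b + p * j)) f) with hw
  have hcoeff : ∀ j ≤ D, w.coeff j = coeff (pt (a + q * (D - j)) (b + p * j)) f := fun j hj => by
    rw [hw, Polynomial.finsetSum_coeff, Finset.sum_eq_single_of_mem j
      (Finset.mem_range_succ_iff.2 hj), Polynomial.coeff_monomial_same]
    exact fun i _ hij => Polynomial.coeff_monomial_of_ne _ hij.symm
  refine ⟨w, Polynomial.natDegree_sum_le_of_forall_le _ _ fun j hj =>
    (Polynomial.natDegree_monomial_le _).trans (Finset.mem_range_succ_iff.1 hj), ext fun n => ?_⟩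
  by_cases hn : ∃ j ≤ D, n = pt (a + q * (D - j)) (b + p * j)
  · obtain ⟨j, hj, rfl⟩ := hn
    rw [coeff_lineSeries hp hj, hcoeff j hj]
  · rw [not_imp_comm.1 exists_of_coeff_lineSeries_ne_zero hn, not_imp_comm.1 (hf n) hn]

theorem IsSegment.exists_initialSpace_eq (hp : 0 < L.p) (h : IsSegment (expo I) L a b D) :
    ∃ W : Submodule ℂ (Polynomial ℂ), (∀ w ∈ W, w.natDegree ≤ D) ∧ (∃ w ∈ W, w.coeff 0 ≠ 0) ∧
      (∃ w ∈ W, w.coeff D ≠ 0) ∧ initialSpace I L = W.map (lineSeries a b L.p L.q D) := by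
  set φ := lineSeries a b L.p L.q D
  have hφ : ∀ g ∈ initialSpace I L, ∃ w : Polynomial ℂ, w.natDegree ≤ D ∧ φ w = g := fun g hg =>
    exists_lineSeries_eq hp fun n hn => by
      obtain ⟨j, hj, hnj⟩ := h.exists_eq (n 0, n 1) (mem_edge_expo_iff.2 ⟨g, hg, by simpa using hn⟩)
      exact ⟨j, hj, (pt_eq_iff.2 (Prod.ext_iff.1 hnj.symm)).symm⟩
  have hmem : ∀ {w : Polynomial ℂ}, w ∈ (initialSpace I L).comap φ ⊓ Polynomial.degreeLE ℂ D ↔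
      φ w ∈ initialSpace I L ∧ w.natDegree ≤ D := fun {w} => by
    rw [Submodule.mem_inf, Submodule.mem_comap, Polynomial.mem_degreeLE,
      Polynomial.natDegree_le_iff_degree_le]
  have hcoeff : ∀ j ≤ D, (a + L.q * (D - j), b + L.p * j) ∈ edge (expo I) L →
      ∃ w ∈ (initialSpace I L).comap φ ⊓ Polynomial.degreeLE ℂ D, w.coeff j ≠ 0 := by
    intro j hj he
    obtain ⟨g, hg, hgj⟩ := mem_edge_expo_iff.1 he
    obtain ⟨w, hw, rfl⟩ := hφ g hg
    exact ⟨w, hmem.2 ⟨hg, hw⟩, by rwa [coeff_lineSeries hp hj] at hgj⟩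
  refine ⟨_, fun w hw => (hmem.1 hw).2, hcoeff 0 (Nat.zero_le D) (by simpa using h.bot_mem),
    hcoeff D le_rfl (by simpa using h.top_mem), le_antisymm (fun g hg => ?_) ?_⟩
  · obtain ⟨w, hw, rfl⟩ := hφ g hg
    exact ⟨w, hmem.2 ⟨hg, hw⟩, rfl⟩
  · rintro _ ⟨w, hw, rfl⟩
    exact (hmem.1 hw).1

section PolynomialSpace

open Polynomial

variable {K : Type*} [Field K] {W : Submodule K K[X]}

theorem exists_monic_map_mulLeft_eq (hW : W ≠ ⊥) : ∃ (G : K[X]) (V : Submodule K K[X]),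
    G.Monic ∧ Ideal.span (V : Set K[X]) = ⊤ ∧ V.map (LinearMap.mulLeft K G) = W := by
  classical
  obtain ⟨g, hg⟩ := (IsPrincipalIdealRing.principal (Ideal.span (W : Set K[X]))).1
  have hg0 : g ≠ 0 := by
    rintro rfl
    refine hW ((Submodule.eq_bot_iff W).2 fun w hw => ?_)
    simpa [hg] using Ideal.subset_span (α := K[X]) hw
  set G := normalize g
  have hG : G.Monic := monic_normalize hg0
  have hspan : Ideal.span (W : Set K[X]) = Ideal.span {G} :=
    hg.trans (Ideal.span_singleton_eq_span_singleton.2 (normalize_associated g).symm)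
  have hmap : (W.comap (LinearMap.mulLeft K G)).map (LinearMap.mulLeft K G) = W := by
    refine Submodule.map_comap_eq_of_le fun w hw => ?_
    obtain ⟨v, rfl⟩ := Ideal.mem_span_singleton.1 (hspan ▸ Ideal.subset_span hw)
    exact ⟨v, rfl⟩
  refine ⟨G, _, hG, ?_, hmap⟩
  rw [← Ideal.span_singleton_mul_right_inj hG.ne_zero, Ideal.mul_top, Ideal.span_mul_span',
    Set.singleton_mul, ← hspan]
  exact congrArg (fun V : Submodule K K[X] => Ideal.span (V : Set K[X])) hmap

theorem natDegree_le_of_mul {G v : K[X]} {D : ℕ} (hG : G.Monic) (h : (G * v).natDegree ≤ D) :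
    v.natDegree ≤ D - G.natDegree := by
  rcases eq_or_ne v 0 with rfl | hv
  · simp
  · rw [hG.natDegree_mul' hv] at h
    omega

theorem fg_of_natDegree_le {d : ℕ} (hW : ∀ w ∈ W, w.natDegree ≤ d) : W.FG := by
  classical
  have hle : W ≤ degreeLE K d := fun w hw =>
    mem_degreeLE.2 (natDegree_le_iff_degree_le.1 (hW w hw))
  have : FiniteDimensional K (degreeLE K d) := by
    rw [degreeLE_eq_span_X_pow]
    infer_instance
  exact Module.Finite.iff_fg.1 (Submodule.finiteDimensional_of_le hle)

end PolynomialSpace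

theorem isFaceData_homog {G : Polynomial ℂ} {W : Submodule ℂ (Polynomial ℂ)} (hG : G.Monic)
    (hG0 : G.coeff 0 ≠ 0) (hWd : ∀ w ∈ W, w.natDegree ≤ d) (hWc : ∃ w ∈ W, w.coeff d ≠ 0)
    (hW : Ideal.span (W : Set (Polynomial ℂ)) = ⊤) (hI : initialSpace I L =
      W.map (lineSeries a b L.p L.q (G.natDegree + d) ∘ₗ LinearMap.mulLeft ℂ G)) :
    IsFaceData I L (homog G.natDegree G) d := by
  obtain ⟨s, κ, rfl⟩ := Submodule.fg_iff_exists_fin_generating_family.1 (fg_of_natDegree_le hWd)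
  have hκd : ∀ i, (κ i).natDegree ≤ d := fun i => hWd _ (Submodule.subset_span ⟨i, rfl⟩)
  have hκtop : ∃ i, (κ i).coeff d ≠ 0 := by
    by_contra! hcon
    obtain ⟨w, hw, hwd⟩ := hWc
    have hker : Submodule.span ℂ (Set.range κ) ≤ LinearMap.ker (Polynomial.lcoeff ℂ d) :=
      Submodule.span_le.2 (Set.range_subset_iff.2 hcon)
    exact hwd (hker hw)
  have hκspan : Ideal.span (Set.range κ) = ⊤ := by
    rw [← hW]
    exact (Submodule.span_span_of_tower ℂ (Polynomial ℂ) (Set.range κ)).symm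
  have hFhom := homog_isHomogeneous G.natDegree G
  refine ⟨⟨G.natDegree, hFhom, ?_⟩, ?_, ?_, a, b, s, fun i => homog d (κ i),
    fun i => homog_isHomogeneous _ _, fun g => isUnit_of_dvd_homog hκd hκtop hκspan, ?_⟩
  · have htop := coeff_homog (le_refl G.natDegree) G
    rwa [tsub_self, hG.coeff_natDegree, pt, Finsupp.single_zero, zero_add] at htop
  · rw [X_zero_dvd_iff hFhom, dehom_homog le_rfl, hG.coeff_natDegree]
    exact one_ne_zero
  · rwa [X_one_dvd_iff hFhom, dehom_homog le_rfl]
  · simp only [mul_assoc, ← map_mul]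
    simp only [← mul_assoc, ← homog_mul le_rfl (hκd _),
      mul_aeval_eq_lineSeries (homog_isHomogeneous _ _),
      dehom_homog (Polynomial.natDegree_mul_le_of_le le_rfl (hκd _))]
    rw [initialIdeal_eq_span, hI, Submodule.map_span, ← Set.range_comp]
    exact Submodule.span_span_of_tower _ _ _

theorem exists_isFaceData (h : IsFace I L) : ∃ F d, IsFaceData I L F d := by
  rw [isFace_iff] at h
  obtain ⟨a, b, D, hseg⟩ := h.exists_isSegment
  obtain ⟨W, hWD, ⟨w₀, hw₀, hw₀c⟩, ⟨w₁, hw₁, hw₁c⟩, hW⟩ := hseg.exists_initialSpace_eq h.p_pos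
  have hWbot : W ≠ ⊥ := by
    rintro rfl
    simp [(Submodule.mem_bot ℂ).1 hw₀] at hw₀c
  obtain ⟨G, V, hG, hVspan, rfl⟩ := exists_monic_map_mulLeft_eq hWbot
  have hVd : ∀ v ∈ V, v.natDegree ≤ D - G.natDegree := fun v hv =>
    natDegree_le_of_mul hG (hWD _ ⟨v, hv, rfl⟩)
  obtain ⟨v₀, -, rfl⟩ := hw₀
  obtain ⟨v₁, hv₁, rfl⟩ := hw₁
  rw [LinearMap.mulLeft_apply] at hw₀c hw₁c
  have hGD : G.natDegree ≤ D := by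
    have hv₁0 : v₁ ≠ 0 := by
      rintro rfl
      simp at hw₁c
    have hdeg := hWD _ ⟨v₁, hv₁, rfl⟩
    rw [LinearMap.mulLeft_apply, hG.natDegree_mul' hv₁0] at hdeg
    omega
  obtain ⟨d, rfl⟩ := Nat.exists_eq_add_of_le hGD
  rw [Nat.add_sub_cancel_left] at hVd
  rw [Polynomial.mul_coeff_zero] at hw₀c
  rw [Polynomial.coeff_mul_add_eq_of_natDegree_le le_rfl (hVd v₁ hv₁)] at hw₁c
  exact ⟨_, d, isFaceData_homog hG (left_ne_zero_of_mul hw₀c) hVd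
    ⟨v₁, hv₁, right_ne_zero_of_mul hw₁c⟩ hVspan (by rw [hW, ← Submodule.map_comp])⟩

end Existence

/-! ### Newton maps and roots of face polynomials -/

section NewtonMaps

theorem exists_comp_eq_X_pow_mul {K : Type*} [CommRing K] [IsDomain K] {G r : Polynomial K}
    (hG : G ≠ 0) (hr : r.derivative.eval 0 ≠ 0) :
    ∃ h : Polynomial K, G.comp r = Polynomial.X ^ G.rootMultiplicity (r.eval 0) * h ∧
      h.eval 0 ≠ 0 := by
  obtain ⟨s, hs⟩ : Polynomial.X ∣ r - Polynomial.C (r.eval 0) := by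
    rw [Polynomial.X_dvd_iff, Polynomial.coeff_zero_eq_eval_zero, Polynomial.eval_sub,
      Polynomial.eval_C, sub_self]
  have hs0 : s.eval 0 = r.derivative.eval 0 := by
    simpa [eq_comm] using congrArg (fun f => f.derivative.eval 0) hs
  obtain ⟨G₁, hG₁, hG₁0⟩ :=
    Polynomial.exists_eq_pow_rootMultiplicity_mul_and_not_dvd G hG (r.eval 0)
  refine ⟨s ^ G.rootMultiplicity (r.eval 0) * G₁.comp r, ?_, ?_⟩
  · conv_lhs => rw [hG₁]
    rw [Polynomial.mul_comp, Polynomial.pow_comp, Polynomial.sub_comp, Polynomial.X_comp,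
      Polynomial.C_comp, hs, mul_pow, mul_assoc]
  · rw [Polynomial.eval_mul, Polynomial.eval_pow, Polynomial.eval_comp, hs0]
    exact mul_ne_zero (pow_ne_zero _ hr) fun h => hG₁0 (Polynomial.dvd_iff_isRoot.2 h)

theorem coeff_C_mul_X_pow_mul_aeval (m i j : ℕ) (c : ℂ) (w : Polynomial ℂ) :
    coeff (pt i j) (C c * ((X 0 : PS) ^ m * Polynomial.aeval (X 1 : PS) w)) =
      if i = m then c * w.coeff j else 0 := by
  classical
  rw [coeff_C_mul]
  induction w using Polynomial.induction_on' with
  | add v w hv hw =>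
    rw [map_add, mul_add, map_add, mul_add, hv, hw, Polynomial.coeff_add]
    split_ifs <;> ring
  | monomial k r =>
    have hmonomial : (X 0 : PS) ^ m * Polynomial.aeval (X 1 : PS) (Polynomial.monomial k r) =
        monomial (pt m k) r := by
      rw [Polynomial.aeval_monomial, monomial_pt, mul_left_comm]
      rfl
    rw [hmonomial, coeff_monomial, Polynomial.coeff_monomial]
    simp only [pt_inj]
    split_ifs <;> first | omega | simp

variable (σ : NewtonMap)

theorem NewtonMap.hom_X (i : Fin 2) : σ.hom (X i) = σ.image i := by
  rw [NewtonMap.hom, substAlgHom_X]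

/-- The image of `y` under a Newton map without the power of `x`, as a polynomial in `y`. -/
noncomputable def NewtonMap.shift : Polynomial ℂ :=
  Polynomial.X + Polynomial.C (σ.μ ^ σ.p')

theorem NewtonMap.shift_eval_zero : σ.shift.eval 0 = σ.μ ^ σ.p' := by
  simp [NewtonMap.shift]

theorem NewtonMap.image_pow_mul_image_pow (a b : ℕ) :
    σ.image 0 ^ a * σ.image 1 ^ b = C (σ.μ ^ (σ.q' * a)) *
      ((X 0 : PS) ^ (σ.p * a + σ.q * b) * Polynomial.aeval (X 1 : PS) (σ.shift ^ b)) := by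
  have hshift : Polynomial.aeval (X 1 : PS) σ.shift = X 1 + C (σ.μ ^ σ.p') := by
    rw [NewtonMap.shift, map_add, Polynomial.aeval_X, Polynomial.aeval_C]
    rfl
  rw [map_pow (Polynomial.aeval _), hshift]
  simp only [NewtonMap.image, Matrix.cons_val_zero, Matrix.cons_val_one, map_pow]
  rw [mul_pow (X 0 ^ σ.q)]
  ring

theorem NewtonMap.coeff_hom (f : PS) (i j : ℕ) :
    coeff (pt i j) (σ.hom f) = ∑ᶠ n : Fin 2 →₀ ℕ, coeff n f *
      if i = σ.p * n 0 + σ.q * n 1 then σ.μ ^ (σ.q' * n 0) * (σ.shift ^ n 1).coeff j else 0 := by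
  rw [NewtonMap.hom, substAlgHom_apply, coeff_subst σ.hasSubst_image]
  refine finsum_congr fun n => ?_
  rw [Finsupp.prod_fintype _ _ (fun _ => pow_zero _), Fin.prod_univ_two,
    σ.image_pow_mul_image_pow, coeff_C_mul_X_pow_mul_aeval, smul_eq_mul]

theorem NewtonMap.coeff_hom_initialPart (f : PS) (N j : ℕ) :
    coeff (pt N j) (σ.hom (initialPart ⟨σ.p, σ.q, N⟩ f)) = coeff (pt N j) (σ.hom f) := by
  rw [σ.coeff_hom, σ.coeff_hom]
  refine finsum_congr fun n => ?_
  rw [coeff_initialPart]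
  simp only [eq_comm (a := N)]
  split_ifs <;> simp

theorem NewtonMap.coeff_hom_eq_zero {f : PS} {N i : ℕ}
    (hf : ∀ n, coeff n f ≠ 0 → N ≤ σ.p * n 0 + σ.q * n 1) (hi : i < N) (j : ℕ) :
    coeff (pt i j) (σ.hom f) = 0 := by
  rw [σ.coeff_hom, finsum_eq_zero_of_forall_eq_zero]
  intro n
  by_cases hn : coeff n f = 0
  · rw [hn, zero_mul]
  · rw [if_neg (hi.trans_le (hf n hn)).ne, mul_zero]

theorem NewtonMap.hom_monomial (a b : ℕ) (c : ℂ) :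
    σ.hom (monomial (pt a b) c) = C (c * σ.μ ^ (σ.q' * a)) *
      ((X 0 : PS) ^ (σ.p * a + σ.q * b) * Polynomial.aeval (X 1 : PS) (σ.shift ^ b)) := by
  have hC : σ.hom (C c) = C c := σ.hom.commutes c
  rw [monomial_pt, map_mul, map_mul, map_pow, map_pow, σ.hom_X, σ.hom_X,
    σ.image_pow_mul_image_pow, hC, map_mul, mul_assoc]

/-- The polynomial `μ^(-q q') (y + μ^p')^p`. Up to powers of `μ` and `x`, the Newton map sends
`y^p / x^q` to it, and it takes the value `μ` at `y = 0` to first order. -/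
noncomputable def NewtonMap.localRoot : Polynomial ℂ :=
  Polynomial.C (σ.μ ^ (σ.q * σ.q'))⁻¹ * σ.shift ^ σ.p

theorem NewtonMap.localRoot_eval_zero : σ.localRoot.eval 0 = σ.μ := by
  have hμ := σ.μ_ne_zero
  rw [NewtonMap.localRoot, Polynomial.eval_mul, Polynomial.eval_C, Polynomial.eval_pow,
    σ.shift_eval_zero, ← pow_mul, mul_comm σ.p', σ.bezout, pow_succ]
  field_simp

theorem NewtonMap.derivative_localRoot_eval_zero_ne_zero :
    σ.localRoot.derivative.eval 0 ≠ 0 := by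
  have hμ := σ.μ_ne_zero
  have hp : (σ.p : ℂ) ≠ 0 := Nat.cast_ne_zero.2 σ.p_pos.ne'
  simp [NewtonMap.localRoot, NewtonMap.shift, Polynomial.derivative_pow, hμ, hp]

theorem NewtonMap.hom_lineSeries (a b : ℕ) {D : ℕ} {w : Polynomial ℂ} (hw : w.natDegree ≤ D) :
    σ.hom (lineSeries a b σ.p σ.q D w) = C (σ.μ ^ (σ.q' * (a + σ.q * D))) *
      ((X 0 : PS) ^ (σ.p * a + σ.q * b + σ.p * σ.q * D) *
        Polynomial.aeval (X 1 : PS) (σ.shift ^ b * w.comp σ.localRoot)) := by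
  have hμ := σ.μ_ne_zero
  rw [lineSeries_apply, map_sum, Polynomial.comp, Polynomial.eval₂_eq_sum_range' _
    (Nat.lt_succ_of_le hw), Finset.mul_sum, map_sum, Finset.mul_sum, Finset.mul_sum]
  refine Finset.sum_congr rfl fun i hi => ?_
  have hiD : i ≤ D := Nat.lt_succ_iff.1 (Finset.mem_range.1 hi)
  have hpoly : σ.shift ^ b * (Polynomial.C (w.coeff i) * σ.localRoot ^ i) =
      Polynomial.C (w.coeff i * (σ.μ ^ (σ.q * σ.q'))⁻¹ ^ i) * σ.shift ^ (b + σ.p * i) := by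
    rw [NewtonMap.localRoot, Polynomial.C_mul, Polynomial.C_pow]
    ring
  have hscalar : w.coeff i * σ.μ ^ (σ.q' * (a + σ.q * (D - i))) =
      σ.μ ^ (σ.q' * (a + σ.q * D)) * (w.coeff i * (σ.μ ^ (σ.q * σ.q'))⁻¹ ^ i) := by
    obtain ⟨e, rfl⟩ := Nat.exists_eq_add_of_le hiD
    rw [Nat.add_sub_cancel_left, inv_pow]
    field_simp
    ring
  have hC (r : ℂ) : Polynomial.aeval (X 1 : PS) (Polynomial.C r) = C r := Polynomial.aeval_C _ r
  rw [σ.hom_monomial, weight_lineSeries hiD, hpoly, map_mul (Polynomial.aeval _), hC, hscalar,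
    map_mul (C : ℂ →+* PS)]
  ring

end NewtonMaps

section Transform

variable {I : Ideal PS} {L : Line} {σ : NewtonMap} {N a b d a' b' d' : ℕ} {G G' v : Polynomial ℂ}
  {W W' : Submodule ℂ (Polynomial ℂ)} {F F' : MvPolynomial (Fin 2) ℂ}

theorem isLowerSet_toLex_lt (m : ℕ × ℕ) :
    IsLowerSet {n : Fin 2 →₀ ℕ | toLex (n 0, n 1) < toLex m} := by
  intro n n' hle hn
  refine lt_of_le_of_lt ?_ (show toLex (n 0, n 1) < toLex m from hn)
  exact Prod.Lex.toLex_mono ⟨hle 0, hle 1⟩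

theorem IsNormalForm.exists_initialPart_eq (h : IsNormalForm I L a b d G W) {f : PS} (hf : f ∈ I) :
    ∃ w ∈ W, initialPart L f = lineSeries a b L.p L.q (G.natDegree + d) (G * w) := by
  have hmem : initialPartₗ L f ∈ initialSpace I L := Submodule.mem_map_of_mem hf
  rw [h.initialSpace_eq] at hmem
  obtain ⟨w, hw, hwf⟩ := hmem
  exact ⟨w, hw, hwf.symm⟩

theorem IsNormalForm.coeff_hom (h : IsNormalForm I ⟨σ.p, σ.q, N⟩ a b d G W)
    (hv : G.comp σ.localRoot = Polynomial.X ^ G.rootMultiplicity σ.μ * v) {f : PS}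
    {w : Polynomial ℂ} (hw : w ∈ W)
    (hf : initialPart ⟨σ.p, σ.q, N⟩ f = lineSeries a b σ.p σ.q (G.natDegree + d) (G * w)) (j : ℕ) :
    coeff (pt N j) (σ.hom f) = σ.μ ^ (σ.q' * (a + σ.q * (G.natDegree + d))) *
      (Polynomial.X ^ G.rootMultiplicity σ.μ *
        (σ.shift ^ b * v * w.comp σ.localRoot)).coeff j := by
  have hdeg : (G * w).natDegree ≤ G.natDegree + d :=
    Polynomial.natDegree_mul_le.trans (Nat.add_le_add_left (h.natDegree_le w hw) _)
  have hcomp : σ.shift ^ b * (G * w).comp σ.localRoot =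
      Polynomial.X ^ G.rootMultiplicity σ.μ * (σ.shift ^ b * v * w.comp σ.localRoot) := by
    rw [Polynomial.mul_comp, hv]
    ring
  rw [← σ.coeff_hom_initialPart, hf, σ.hom_lineSeries a b hdeg, coeff_C_mul_X_pow_mul_aeval,
    if_pos h.weight_eq, hcomp]

theorem IsNormalForm.isLeast_transform (h : IsNormalForm I ⟨σ.p, σ.q, N⟩ a b d G W)
    (hN : ∀ e ∈ expo I, N ≤ σ.p * e.1 + σ.q * e.2) :
    IsLeast (toLex '' expo (σ.transform I)) (toLex (N, G.rootMultiplicity σ.μ)) := by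
  have hμ := σ.μ_ne_zero
  obtain ⟨v, hv, hv0⟩ :=
    exists_comp_eq_X_pow_mul h.monic.ne_zero σ.derivative_localRoot_eval_zero_ne_zero
  rw [σ.localRoot_eval_zero] at hv
  constructor
  · obtain ⟨w, hw, hwμ⟩ := h.exists_eval_ne_zero σ.μ
    obtain ⟨f, hf, hfw⟩ := h.lineSeries_mem hw
    refine ⟨_, ⟨σ.hom f, Ideal.mem_map_of_mem _ hf, ?_⟩, rfl⟩
    rw [h.coeff_hom hv hw hfw, Polynomial.coeff_X_pow_mul', if_pos le_rfl, tsub_self,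
      Polynomial.coeff_zero_eq_eval_zero, Polynomial.eval_mul, Polynomial.eval_mul,
      Polynomial.eval_pow, Polynomial.eval_comp, σ.localRoot_eval_zero, σ.shift_eval_zero]
    exact mul_ne_zero (pow_ne_zero _ hμ)
      (mul_ne_zero (mul_ne_zero (pow_ne_zero _ (pow_ne_zero _ hμ)) hv0) hwμ)
  · have hvanish : σ.transform I ≤
        vanishingIdeal (isLowerSet_toLex_lt (N, G.rootMultiplicity σ.μ)) := by
      refine Ideal.map_le_iff_le_comap.2 fun f hf n hn => ?_
      rw [← pt_eta n]
      rcases Prod.Lex.toLex_lt_toLex.1 hn with hn0 | ⟨hn0, hn1⟩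
      · exact σ.coeff_hom_eq_zero
          (fun e he => hN (e 0, e 1) ⟨f, hf, by simpa using he⟩) hn0 _
      · obtain ⟨w, hw, hwf⟩ := h.exists_initialPart_eq hf
        simp only at hn0 hn1
        rw [hn0, h.coeff_hom hv hw hwf, Polynomial.coeff_X_pow_mul', if_neg hn1.not_ge,
          mul_zero]
    rintro _ ⟨e, ⟨g, hg, hge⟩, rfl⟩
    by_contra! hlt
    exact hge (hvanish hg _ (by simpa using hlt))

theorem exists_newtonMap {p q : ℕ} (hp : 0 < p) (hq : 0 < q) (hpq : p.Coprime q) {μ : ℂ}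
    (hμ : μ ≠ 0) : ∃ σ : NewtonMap, σ.p = p ∧ σ.q = q ∧ σ.μ = μ := by
  obtain ⟨p', hp'q, q', hb⟩ : ∃ p' ≤ q, ∃ q', p * p' = q * q' + 1 := by
    rcases Nat.lt_or_ge 1 q with hq1 | hq1
    · obtain ⟨m, hm⟩ := Nat.exists_mul_mod_eq_one_of_coprime hpq hq1
      refine ⟨m, hm.1.le, p * m / q, ?_⟩
      have := Nat.div_add_mod (p * m) q
      omega
    · obtain rfl : q = 1 := by omega
      exact ⟨1, le_rfl, p - 1, by omega⟩
  refine ⟨⟨p, q, μ, p', q', hp, hq, hμ, hb, hp'q, ?_⟩, rfl, rfl, rfl⟩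
  refine Nat.lt_of_mul_lt_mul_left (a := q) ?_
  calc q * q' < p * p' := by omega
    _ ≤ p * q := Nat.mul_le_mul_left p hp'q
    _ = q * p := mul_comm p q

theorem NewtonMap.coprime (σ : NewtonMap) : σ.p.Coprime σ.q := by
  have hdvd : σ.p.gcd σ.q ∣ σ.q * σ.q' + 1 := σ.bezout ▸ (Nat.gcd_dvd_left _ _).mul_right _
  exact Nat.dvd_one.1 ((Nat.dvd_add_right ((Nat.gcd_dvd_right σ.p σ.q).mul_right _)).1 hdvd)

theorem NewtonMap.p'_pos (σ : NewtonMap) : 0 < σ.p' :=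
  Nat.pos_of_ne_zero fun h0 => by simpa [h0] using σ.bezout

theorem NewtonMap.ext_of_eq {σ τ : NewtonMap} (hp : σ.p = τ.p) (hq : σ.q = τ.q) (hμ : σ.μ = τ.μ) :
    σ = τ := by
  have hp' : σ.p' = τ.p' := by
    have hmod : σ.p * σ.p' ≡ σ.p * τ.p' [MOD σ.q] := by
      rw [σ.bezout, hp, τ.bezout, ← hq]
      simp [Nat.ModEq]
    have hmod' := hmod.cancel_left_of_coprime σ.coprime.symm
    have hσ := And.intro σ.p'_pos σ.p'_le
    have hτ := And.intro τ.p'_pos τ.p'_le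
    exact hmod'.eq_of_abs_lt (abs_lt.2 ⟨by omega, by omega⟩)
  have hq' : σ.q' = τ.q' := by
    have hb := σ.bezout
    rw [hp, hp', τ.bezout, hq] at hb
    exact (Nat.eq_of_mul_eq_mul_left τ.q_pos (Nat.succ_injective hb)).symm
  cases σ
  cases τ
  simp only at hp hq hμ hp' hq'
  subst hp hq hμ hp' hq'
  rfl

theorem roots_eq_of_isNormalForm (hL : IsLatticeFace (expo I) L) (h : IsNormalForm I L a b d G W)
    (h' : IsNormalForm I L a' b' d' G' W') : G.roots = G'.roots := by
  obtain ⟨p, q, N⟩ := L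
  ext μ
  rw [Polynomial.count_roots, Polynomial.count_roots]
  by_cases hμ : μ = 0
  · have hzero {G : Polynomial ℂ} (hG : G.coeff 0 ≠ 0) : G.rootMultiplicity μ = 0 := by
      rw [hμ]
      exact Polynomial.rootMultiplicity_eq_zero fun hroot =>
        hG ((Polynomial.coeff_zero_eq_eval_zero G).trans hroot)
    rw [hzero h.coeff_zero, hzero h'.coeff_zero]
  · obtain ⟨σ, rfl, rfl, rfl⟩ := exists_newtonMap hL.p_pos hL.q_pos hL.coprime hμ
    simpa using (h.isLeast_transform hL.le).unique (h'.isLeast_transform hL.le)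

theorem IsFaceData.unique (hL : IsFace I L) (h : IsFaceData I L F d) (h' : IsFaceData I L F' d') :
    (dehom F).roots = (dehom F').roots ∧ d = d' := by
  have hface := isFace_iff.1 hL
  obtain ⟨a, b, W, hn⟩ := h.exists_isNormalForm hL.1 hL.2.1
  obtain ⟨a', b', W', hn'⟩ := h'.exists_isNormalForm hL.1 hL.2.1
  have hroots := roots_eq_of_isNormalForm hface hn hn'
  have hdeg : (dehom F).natDegree = (dehom F').natDegree := by
    rw [← IsAlgClosed.card_roots_eq_natDegree, hroots, IsAlgClosed.card_roots_eq_natDegree]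
  have hlength := (hn.isSegment hL.1).length_unique hL.1 (hn'.isSegment hL.1)
  exact ⟨hroots, by omega⟩

theorem IsFaceData.ne_zero_of_mem_roots (hL : IsFace I L) (h : IsFaceData I L F d) {μ : ℂ}
    (hμ : μ ∈ (dehom F).roots) : μ ≠ 0 := by
  rintro rfl
  obtain ⟨a, b, W, hn⟩ := h.exists_isNormalForm hL.1 hL.2.1
  exact hn.coeff_zero ((Polynomial.coeff_zero_eq_eval_zero _).trans (Polynomial.mem_roots'.1 hμ).2)

end Transform

/-! ### The height of an ideal containing a power of `x` -/

section Height

variable {J : Ideal PS} {k ν n : ℕ}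

/-- The ideal `J` has the form `x^k J'` where `J'` contains `x^n`, and `ν` is the height of its
Newton polygon: the least order in `y` of an element of `J'` restricted to `x = 0`. Equivalently
`(k, ν)` is the lexicographically least exponent of `J`. All ideals in the Newton tree of an ideal
of finite codimension have this form, and `(ν, n)` decreases lexicographically along the tree. -/
structure HasHeight (J : Ideal PS) (k ν n : ℕ) : Prop where
  isLeast : IsLeast (toLex '' expo J) (toLex (k, ν))
  X_pow_mem : (X 0 : PS) ^ (k + n) ∈ J

theorem X_zero_pow_eq_monomial (N : ℕ) : (X 0 : PS) ^ N = monomial (pt N 0) 1 := by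
  rw [monomial_pt, map_one, one_mul, pow_zero, mul_one]

theorem mem_expo_of_X_zero_pow_mem {N : ℕ} (h : (X 0 : PS) ^ N ∈ J) : (N, 0) ∈ expo J := by
  refine ⟨_, h, ?_⟩
  rw [X_zero_pow_eq_monomial, coeff_monomial_same]
  exact one_ne_zero

theorem not_dvd_X_zero_pow {f : PS} (h0 : constantCoeff f = 0) {j : ℕ}
    (hj : coeff (pt 0 j) f ≠ 0) (N : ℕ) : ¬ f ∣ (X 0 : PS) ^ N := by
  rintro ⟨g, hg⟩
  have hX : (X 0 : PS) ^ N ≠ 0 := by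
    intro hzero
    obtain ⟨p, hp, hpc⟩ : (N, 0) ∈ expo (⊥ : Ideal PS) := mem_expo_of_X_zero_pow_mem hzero
    exact hpc (by rw [Ideal.mem_bot.1 hp, map_zero])
  obtain ⟨m, hm⟩ := exists_finsupp_eq_lexOrder_of_ne_zero (left_ne_zero_of_mul (hg ▸ hX))
  obtain ⟨m', hm'⟩ := exists_finsupp_eq_lexOrder_of_ne_zero (right_ne_zero_of_mul (hg ▸ hX))
  have hfm := coeff_ne_zero_of_lexOrder hm.symm
  have hprod : coeff (m + m') ((X 0 : PS) ^ N) ≠ 0 := by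
    rw [hg, coeff_mul_of_add_lexOrder hm hm']
    exact mul_ne_zero hfm (coeff_ne_zero_of_lexOrder hm'.symm)
  have hm1 : m 1 = 0 := by
    classical
    rw [X_zero_pow_eq_monomial, coeff_monomial, ne_eq, ite_eq_right_iff, Classical.not_imp] at hprod
    have := DFunLike.congr_fun hprod.1 1
    simp only [Finsupp.add_apply, pt_one] at this
    omega
  have hm0 : m 0 = 0 := by
    have hle : toLex m ≤ toLex (pt 0 j) :=
      WithTop.coe_le_coe.1 (hm ▸ lexOrder_le_of_coeff_ne_zero hj)
    by_contra hpos
    exact hle.not_gt (Finsupp.Lex.lt_iff.2 ⟨0, by simp, by simpa [Nat.pos_iff_ne_zero] using hpos⟩)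
  refine hfm ?_
  rw [show m = 0 by ext i; fin_cases i <;> assumption]
  exact h0

theorem HasHeight.mem_expo (h : HasHeight J k ν n) : (k, ν) ∈ expo J :=
  toLex.injective.mem_set_image.1 h.isLeast.1

theorem HasHeight.toLex_le (h : HasHeight J k ν n) {e : ℕ × ℕ} (he : e ∈ expo J) :
    k < e.1 ∨ k = e.1 ∧ ν ≤ e.2 :=
  Prod.Lex.toLex_le_toLex.1 (h.isLeast.2 (Set.mem_image_of_mem _ he))

theorem HasHeight.axis_mem_expo (h : HasHeight J k ν n) : (k + n, 0) ∈ expo J :=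
  mem_expo_of_X_zero_pow_mem h.X_pow_mem

theorem HasHeight.isLeast_snd (h : HasHeight J k ν n) : IsLeast (Prod.snd '' expo J) 0 :=
  ⟨⟨_, h.axis_mem_expo, rfl⟩, fun _ _ => Nat.zero_le _⟩

theorem HasHeight.X_pow_dvd (h : HasHeight J k ν n) {f : PS} (hf : f ∈ J) :
    (X 0 : PS) ^ k ∣ f := by
  rw [X_pow_dvd_iff]
  intro m hm
  by_contra hne
  have := h.toLex_le (e := (m 0, m 1)) ⟨f, hf, by simpa using hne⟩
  omega

theorem HasHeight.eq_zero_of_isDepthZero (h : HasHeight J k ν n) (hJ : IsDepthZero J) : ν = 0 := by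
  obtain ⟨a, b, t, ht, ht0, rfl⟩ := hJ
  have hb : b = 0 := by
    by_contra hb
    refine not_dvd_X_zero_pow (f := X 1 + t) (by simp [ht0]) (j := 1) ?_ (k + n)
      (((dvd_pow_self _ hb).mul_left _).trans (Ideal.mem_span_singleton.1 h.X_pow_mem))
    rw [map_add, ht _ (by simp), add_zero, ← pow_one (X 1 : PS), X_pow_eq]
    simp [pt]
  subst hb
  rw [pow_zero, mul_one] at h
  obtain ⟨f, hf, hfc⟩ := h.mem_expo
  have hak : a ≤ k := by
    by_contra! hlt
    exact hfc (X_pow_dvd_iff.1 (Ideal.mem_span_singleton.1 hf) _ (by simpa using hlt))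
  have hle := h.toLex_le (mem_expo_of_X_zero_pow_mem (Ideal.mem_span_singleton_self _))
  omega

theorem HasHeight.isDepthZero (h : HasHeight J k 0 n) : IsDepthZero J := by
  refine ⟨k, 0, 0, by simp, by simp, ?_⟩
  rw [pow_zero, mul_one]
  refine le_antisymm (fun f hf => Ideal.mem_span_singleton.2 (h.X_pow_dvd hf)) ?_
  rw [Ideal.span_singleton_le_iff_mem]
  obtain ⟨f, hf, hfc⟩ := h.mem_expo
  obtain ⟨u, rfl⟩ := h.X_pow_dvd hf
  have hu : coeff (pt k 0) ((X 0 : PS) ^ k * u) = constantCoeff u := by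
    rw [X_zero_pow_eq_monomial, coeff_monomial_mul, if_pos le_rfl, one_mul, tsub_self]
    rfl
  rw [hu] at hfc
  exact (Ideal.mul_unit_mem_iff_mem J (isUnit_iff_constantCoeff.2 (IsUnit.mk0 _ hfc))).1 hf

theorem HasHeight.isDepthZero_iff (h : HasHeight J k ν n) : IsDepthZero J ↔ ν = 0 :=
  ⟨h.eq_zero_of_isDepthZero, by rintro rfl; exact h.isDepthZero⟩

variable {σ : NewtonMap} {N d : ℕ} {F : MvPolynomial (Fin 2) ℂ}

theorem NewtonMap.X_zero_pow_mem_transform {m : ℕ} (σ : NewtonMap) (h : (X 0 : PS) ^ m ∈ J) :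
    (X 0 : PS) ^ (σ.p * m) ∈ σ.transform J := by
  have himage : σ.hom (X 0 ^ m) = C (σ.μ ^ σ.q') ^ m * (X 0 : PS) ^ (σ.p * m) := by
    rw [map_pow, σ.hom_X, NewtonMap.image, Matrix.cons_val_zero, mul_pow, ← pow_mul]
  have hunit : IsUnit (C (σ.μ ^ σ.q') ^ m : PS) :=
    ((IsUnit.mk0 _ (pow_ne_zero _ σ.μ_ne_zero)).map (C : ℂ →+* PS)).pow _
  exact (Ideal.unit_mul_mem_iff_mem _ hunit).1 (himage ▸ Ideal.mem_map_of_mem _ h)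

theorem HasHeight.transform (h : HasHeight J k ν n) (hL : IsFace J ⟨σ.p, σ.q, N⟩)
    (hF : IsFaceData J ⟨σ.p, σ.q, N⟩ F d) :
    HasHeight (σ.transform J) N ((dehom F).rootMultiplicity σ.μ) (σ.p * (k + n) - N) := by
  have hface := isFace_iff.1 hL
  obtain ⟨a, b, W, hn⟩ := hF.exists_isNormalForm hL.1 hL.2.1
  refine ⟨hn.isLeast_transform hface.le, ?_⟩
  have hN : N ≤ σ.p * (k + n) := by simpa using hface.le _ h.axis_mem_expo
  rw [Nat.add_sub_cancel' hN]
  exact σ.X_zero_pow_mem_transform h.X_pow_mem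

theorem HasHeight.transform_lt (h : HasHeight J k ν n) (hν : 0 < ν)
    (hL : IsFace J ⟨σ.p, σ.q, N⟩) (hF : IsFaceData J ⟨σ.p, σ.q, N⟩ F d) :
    (dehom F).rootMultiplicity σ.μ < ν ∨
      (dehom F).rootMultiplicity σ.μ = ν ∧ σ.p * (k + n) - N < n := by
  have hface := isFace_iff.1 hL
  obtain ⟨a, b, W, hn⟩ := hF.exists_isNormalForm hL.1 hL.2.1
  have hmult : (dehom F).rootMultiplicity σ.μ ≤ (dehom F).natDegree := by
    rw [← Polynomial.count_roots]
    exact (Multiset.count_le_card _ _).trans (Polynomial.card_roots' _)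
  have htop := (hn.isSegment hL.1).top_mem.1
  have hweight := hn.weight_eq
  have hcorner := hface.le _ h.mem_expo
  have haxis := hface.le _ h.axis_mem_expo
  have hka := h.toLex_le htop
  simp only at hweight hcorner haxis hka
  set M := (dehom F).natDegree + d
  have hM : b + σ.p * M ≤ ν := by
    refine Nat.le_of_mul_le_mul_left (c := σ.q) ?_ σ.q_pos
    have := Nat.mul_le_mul_left σ.p (show k ≤ a by omega)
    linarith
  have hpM := Nat.le_mul_of_pos_left M σ.p_pos
  refine (lt_or_ge _ ν).imp_right fun hge => ?_
  have hMν : M = ν := by omega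
  have hp : σ.p = 1 := by
    refine le_antisymm (Nat.le_of_mul_le_mul_right (c := ν) ?_ hν) σ.p_pos
    rw [← hMν]
    omega
  have := Nat.mul_pos σ.q_pos hν
  rw [hp, hMν, one_mul, one_mul] at hweight
  rw [hp, one_mul] at haxis ⊢
  omega

end Height

/-! ### Weighted sums over dicritical vertices -/

section Vertices

/-- The vertex of the Newton tree of an ideal `J` given by a vertex of the Newton tree of `J_σ`. -/
def Vertex.cons (σ : NewtonMap) (v : Vertex) : Vertex :=
  ⟨σ :: v.path, v.face, v.d⟩

/-- The coefficients `(p, q)` of the face at which the path from the root to a vertex starts; the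
face of the vertex itself when the path is empty. -/
def Vertex.slope (v : Vertex) : ℕ × ℕ :=
  match v.path with
  | [] => (v.face.p, v.face.q)
  | σ :: _ => (σ.p, σ.q)

/-- The product of the decorations `p` along the path to a vertex, its own one included. -/
def Vertex.prodP (v : Vertex) : ℕ :=
  (v.path.map NewtonMap.p).prod * v.face.p

/-- The product `g(p₁, q₁) p₂ ⋯ pₙ p` of decorations, with the one of the first face on the path
replaced by a function `g` of the two coefficients of this face. It interpolates between
`Vertex.prodP` and `Vertex.rho`. -/
def Vertex.weight (g : ℕ → ℕ → ℕ) (v : Vertex) : ℕ :=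
  match v.path with
  | [] => g v.face.p v.face.q
  | σ :: l => g σ.p σ.q * ((l.map NewtonMap.p).prod * v.face.p)

theorem Vertex.weight_fst (v : Vertex) : v.weight (fun p _ => p) = v.prodP := by
  obtain ⟨l, L, d⟩ := v
  cases l <;> simp [Vertex.weight, Vertex.prodP, mul_assoc]

theorem Vertex.weight_min (v : Vertex) : v.weight min = v.rho := by
  obtain ⟨l, L, d⟩ := v
  cases l with
  | nil => rfl
  | cons σ l => simp only [Vertex.weight, Vertex.rho, mul_assoc, Nat.mul_min_mul_right]

/-- The set `S` of vertices is finite and the sum of `w(v) d_v` over `v ∈ S` is `s`. Finiteness is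
included because `∑ᶠ` is zero for an infinite support. -/
def HasDegreeSum (S : Set Vertex) (w : Vertex → ℕ) (s : ℕ) : Prop :=
  S.Finite ∧ ∑ᶠ v ∈ S, w v * v.d = s

variable {S T : Set Vertex} {w : Vertex → ℕ} {s t : ℕ}

theorem HasDegreeSum.union (hS : HasDegreeSum S w s) (hT : HasDegreeSum T w t)
    (hST : Disjoint S T) : HasDegreeSum (S ∪ T) w (s + t) :=
  ⟨hS.1.union hT.1, by rw [finsum_mem_union hST hS.1 hT.1, hS.2, hT.2]⟩

theorem HasDegreeSum.biUnion {ι : Type*} {A : Set ι} {S : ι → Set Vertex} {s : ι → ℕ}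
    (hA : A.Finite) (hdisj : A.PairwiseDisjoint S) (hS : ∀ i ∈ A, HasDegreeSum (S i) w (s i)) :
    HasDegreeSum (⋃ i ∈ A, S i) w (∑ᶠ i ∈ A, s i) := by
  refine ⟨hA.biUnion fun i hi => (hS i hi).1, ?_⟩
  rw [finsum_mem_biUnion hdisj hA fun i hi => (hS i hi).1]
  exact finsum_mem_congr rfl fun i hi => (hS i hi).2

theorem HasDegreeSum.image_cons (hS : HasDegreeSum S Vertex.prodP s) (g : ℕ → ℕ → ℕ)
    (σ : NewtonMap) : HasDegreeSum (Vertex.cons σ '' S) (Vertex.weight g) (g σ.p σ.q * s) := by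
  have hinj : Set.InjOn (Vertex.cons σ) S := fun v _ v' _ h => by
    simpa [Vertex.cons, Vertex.ext_iff] using h
  refine ⟨hS.1.image _, ?_⟩
  rw [finsum_mem_image hinj, ← hS.2, mul_finsum_mem' _ _ hS.1]
  exact finsum_mem_congr rfl fun v _ => mul_assoc (g σ.p σ.q) v.prodP v.d

theorem hasDegreeSum_nil (g : ℕ → ℕ → ℕ) (L : Line) (d : ℕ) :
    HasDegreeSum {v | v = ⟨[], L, d⟩ ∧ 0 < v.d} (Vertex.weight g) (g L.p L.q * d) := by
  rcases d.eq_zero_or_pos with rfl | hd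
  · have hempty : {v : Vertex | v = ⟨[], L, 0⟩ ∧ 0 < v.d} = ∅ := by
      ext v
      simp only [Set.mem_ofPred_eq, Set.mem_empty_iff_false, iff_false, not_and, not_lt]
      rintro rfl
      exact le_rfl
    rw [hempty]
    exact ⟨Set.finite_empty, finsum_mem_empty⟩
  · have hsingle : {v : Vertex | v = ⟨[], L, d⟩ ∧ 0 < v.d} = {⟨[], L, d⟩} := by
      ext v
      simp only [Set.mem_ofPred_eq, Set.mem_singleton_iff, and_iff_left_iff_imp]
      rintro rfl
      exact hd
    rw [hsingle]
    exact ⟨Set.finite_singleton _, finsum_mem_singleton⟩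

end Vertices

section Decomposition

variable {J : Ideal PS} {L : Line} {F : MvPolynomial (Fin 2) ℂ} {d : ℕ}

theorem dicriticalVertices_eq_empty (h : IsDepthZero J) : dicriticalVertices J = ∅ := by
  ext ⟨l, L, d⟩
  refine iff_of_false ?_ (Set.notMem_empty _)
  cases l <;> exact fun hv => hv.1.1 h

/-- The Newton maps performed on `J` at the roots of the face polynomial of the face `L`. -/
def stepsAt (J : Ideal PS) (L : Line) : Set NewtonMap :=
  {σ | IsStep J σ ∧ σ.p = L.p ∧ σ.q = L.q}

theorem IsFace.eq_of_slope_eq {L' : Line} (hL : IsFace J L) (hL' : IsFace J L') (hp : L.p = L'.p)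
    (hq : L.q = L'.q) : L = L' :=
  (isFace_iff.1 hL).eq_of_slope_eq (isFace_iff.1 hL') (by rw [hp, hq])

theorem IsFaceData.mem_roots_iff (hL : IsFace J L) (hF : IsFaceData J L F d) {μ : ℂ} :
    μ ∈ (dehom F).roots ↔ MvPolynomial.eval ![1, μ] F = 0 := by
  obtain ⟨a, b, W, hn⟩ := hF.exists_isNormalForm hL.1 hL.2.1
  rw [Polynomial.mem_roots hn.monic.ne_zero, Polynomial.IsRoot, eval_dehom]

theorem bijOn_stepsAt (hL : IsFace J L) (hF : IsFaceData J L F d) :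
    Set.BijOn NewtonMap.μ (stepsAt J L) {μ | μ ∈ (dehom F).roots} := by
  refine ⟨?_, fun σ hσ τ hτ => ?_, fun μ hμ => ?_⟩
  · rintro σ ⟨⟨N, F', d', hL', hF', heval⟩, hp, hq⟩
    obtain rfl := hL'.eq_of_slope_eq hL hp hq
    rw [Set.mem_ofPred_eq, (hF.unique hL hF').1]
    exact (hF'.mem_roots_iff hL).2 heval
  · exact NewtonMap.ext_of_eq (hσ.2.1.trans hτ.2.1.symm) (hσ.2.2.trans hτ.2.2.symm)
  · obtain ⟨σ, hp, hq, rfl⟩ := exists_newtonMap hL.1 hL.2.1 hL.2.2.1 (hF.ne_zero_of_mem_roots hL hμ)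
    obtain ⟨N, rfl⟩ : ∃ N, L = ⟨σ.p, σ.q, N⟩ := ⟨L.N, Line.ext hp.symm hq.symm rfl⟩
    exact ⟨σ, ⟨⟨_, F, d, hL, hF, (hF.mem_roots_iff hL).1 hμ⟩, rfl, rfl⟩, rfl⟩

theorem dicriticalVertices_eq_biUnion (J : Ideal PS) : dicriticalVertices J =
    ⋃ L ∈ latticeFaces (expo J), {v ∈ dicriticalVertices J | v.slope = (L.p, L.q)} := by
  ext v
  simp only [Set.mem_iUnion, Set.mem_ofPred_eq, exists_prop]
  refine ⟨fun hv => ?_, fun ⟨_, _, hv, _⟩ => hv⟩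
  obtain ⟨l, L, d⟩ := v
  cases l with
  | nil => exact ⟨L, isFace_iff.1 hv.1.2.1, hv, rfl⟩
  | cons σ l =>
    obtain ⟨N, -, -, hL, -⟩ := hv.1.2.1
    exact ⟨⟨σ.p, σ.q, N⟩, isFace_iff.1 hL, hv, rfl⟩

theorem setOf_slope_eq (hJ : ¬ IsDepthZero J) (hL : IsFace J L) (hF : IsFaceData J L F d) :
    {v ∈ dicriticalVertices J | v.slope = (L.p, L.q)} = {v | v = ⟨[], L, d⟩ ∧ 0 < v.d} ∪
      ⋃ σ ∈ stepsAt J L, Vertex.cons σ '' dicriticalVertices (σ.transform J) := by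
  ext ⟨l, L', d'⟩
  cases l with
  | nil =>
    have hcons : (⟨[], L', d'⟩ : Vertex) ∉
        ⋃ σ ∈ stepsAt J L, Vertex.cons σ '' dicriticalVertices (σ.transform J) := by
      simp [Vertex.cons]
    rw [Set.mem_union, or_iff_left hcons]
    constructor
    · rintro ⟨⟨⟨-, hL', F', hF'⟩, hd'⟩, hslope⟩
      obtain rfl := hL'.eq_of_slope_eq hL (congrArg Prod.fst hslope) (congrArg Prod.snd hslope)
      obtain rfl := (hF.unique hL hF').2
      exact ⟨rfl, hd'⟩
    · rintro ⟨hv, hd'⟩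
      obtain ⟨-, rfl, rfl⟩ := Vertex.mk.inj hv
      exact ⟨⟨⟨hJ, hL, F, hF⟩, hd'⟩, rfl⟩
  | cons σ l =>
    have hnil : (⟨σ :: l, L', d'⟩ : Vertex) ∉ {v : Vertex | v = ⟨[], L, d⟩ ∧ 0 < v.d} := by simp
    rw [Set.mem_union, or_iff_right hnil]
    simp only [Set.mem_iUnion, exists_prop]
    constructor
    · rintro ⟨⟨⟨-, hstep, hv⟩, hd'⟩, hslope⟩
      exact ⟨σ, ⟨hstep, congrArg Prod.fst hslope, congrArg Prod.snd hslope⟩, ⟨l, L', d'⟩,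
        ⟨hv, hd'⟩, rfl⟩
    · rintro ⟨τ, ⟨hstep, hp, hq⟩, w, ⟨hw, hd'⟩, hv⟩
      obtain ⟨hpath, rfl, rfl⟩ := Vertex.mk.inj hv
      obtain ⟨rfl, rfl⟩ := List.cons.inj hpath
      exact ⟨⟨⟨hJ, hstep, hw⟩, hd'⟩, Prod.ext hp hq⟩

theorem finsum_count_roots (G : Polynomial ℂ) :
    ∑ᶠ μ ∈ {μ | μ ∈ G.roots}, G.rootMultiplicity μ = G.natDegree := by
  classical
  have hcoe : {μ | μ ∈ G.roots} = (G.roots.toFinset : Set ℂ) := by ext; simp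
  rw [hcoe, finsum_mem_coe_finset, ← IsAlgClosed.card_roots_eq_natDegree,
    ← Multiset.toFinset_sum_count_eq]
  exact Finset.sum_congr rfl fun μ _ => (Polynomial.count_roots G).symm

theorem hasDegreeSum_slope (hJ : ¬ IsDepthZero J) (hL : IsFace J L) (hF : IsFaceData J L F d)
    (htransform : ∀ σ ∈ stepsAt J L, HasDegreeSum (dicriticalVertices (σ.transform J))
      Vertex.prodP ((dehom F).rootMultiplicity σ.μ)) (g : ℕ → ℕ → ℕ) :
    HasDegreeSum {v ∈ dicriticalVertices J | v.slope = (L.p, L.q)} (Vertex.weight g)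
      (g L.p L.q * latticeLength (expo J) L) := by
  obtain ⟨a, b, W, hn⟩ := hF.exists_isNormalForm hL.1 hL.2.1
  have hbij := bijOn_stepsAt hL hF
  have hfinite : (stepsAt J L).Finite :=
    hbij.finite_iff_finite.2 (Multiset.finite_toSet _)
  have hcons := HasDegreeSum.biUnion hfinite (S := fun σ => Vertex.cons σ '' dicriticalVertices
      (σ.transform J)) ?_ fun σ hσ => (htransform σ hσ).image_cons g σ
  · have hsum : ∑ᶠ σ ∈ stepsAt J L, g σ.p σ.q * (dehom F).rootMultiplicity σ.μ =
        g L.p L.q * (dehom F).natDegree := by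
      rw [← finsum_count_roots, mul_finsum_mem]
      exact finsum_mem_eq_of_bijOn _ hbij fun σ hσ => by rw [hσ.2.1, hσ.2.2]
    rw [setOf_slope_eq hJ hL hF, (hn.isSegment hL.1).latticeLength_eq hL.1, mul_add, add_comm,
      ← hsum]
    refine (hasDegreeSum_nil g L d).union hcons (Set.disjoint_left.2 ?_)
    rintro _ ⟨rfl, -⟩
    simp [Vertex.cons]
  · intro σ _ τ _ hστ
    refine Set.disjoint_left.2 ?_
    rintro _ ⟨v, -, rfl⟩ ⟨v', -, hv⟩
    exact hστ (List.cons.inj (Vertex.mk.inj hv).1).1.symm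

theorem hasDegreeSum_weight (hfin : (latticeFaces (expo J)).Finite) (hJ : ¬ IsDepthZero J)
    (htransform : ∀ (σ : NewtonMap) (N d : ℕ) (F : MvPolynomial (Fin 2) ℂ),
      IsFace J ⟨σ.p, σ.q, N⟩ → IsFaceData J ⟨σ.p, σ.q, N⟩ F d →
        HasDegreeSum (dicriticalVertices (σ.transform J)) Vertex.prodP
          ((dehom F).rootMultiplicity σ.μ)) (g : ℕ → ℕ → ℕ) :
    HasDegreeSum (dicriticalVertices J) (Vertex.weight g)
      (∑ᶠ L ∈ latticeFaces (expo J), g L.p L.q * latticeLength (expo J) L) := by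
  rw [dicriticalVertices_eq_biUnion]
  refine HasDegreeSum.biUnion hfin (fun L hL L' hL' hne => ?_) fun L hL => ?_
  · refine Set.disjoint_left.2 fun v hv hv' => hne ?_
    obtain ⟨hp, hq⟩ := Prod.mk.inj (hv.2.symm.trans hv'.2)
    exact (isFace_iff.2 hL).eq_of_slope_eq (isFace_iff.2 hL') hp hq
  · have hface := isFace_iff.2 hL
    obtain ⟨F, d, hF⟩ := exists_isFaceData hface
    refine hasDegreeSum_slope hJ hface hF (fun σ hσ => ?_) g
    obtain ⟨N, rfl⟩ : ∃ N, L = ⟨σ.p, σ.q, N⟩ := ⟨L.N, Line.ext hσ.2.1.symm hσ.2.2.symm rfl⟩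
    exact htransform σ _ d F hface hF

end Decomposition

/-! ### Powers of the maximal ideal -/

section MaximalIdeal

variable {σ : Type*}

theorem exists_eq_sum_X_mul {R : Type*} [CommSemiring R] [Fintype σ] {f : MvPowerSeries σ R}
    (hf : constantCoeff f = 0) : ∃ g : σ → MvPowerSeries σ R, f = ∑ s, X s * g s ∧
      ∀ s n, coeff (n + Finsupp.single s 1) f = 0 → coeff n (g s) = 0 := by
  classical
  choose var hvar using fun (n : σ →₀ ℕ) (hn : n ≠ 0) => Finsupp.ne_iff.1 hn
  have hne (s : σ) (n : σ →₀ ℕ) : n + Finsupp.single s 1 ≠ 0 := by simp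
  let g : σ → MvPowerSeries σ R := fun s n =>
    if var _ (hne s n) = s then coeff (n + Finsupp.single s 1) f else 0
  have hg (s n) : coeff n (g s) =
      if var _ (hne s n) = s then coeff (n + Finsupp.single s 1) f else 0 := rfl
  refine ⟨g, ?_, fun s n h => by rw [hg, h, ite_self]⟩
  ext n
  simp only [map_sum, X_def, coeff_monomial_mul, one_mul]
  rcases eq_or_ne n 0 with rfl | hn
  · simpa using hf
  have hterm (s : σ) :
      (if Finsupp.single s 1 ≤ n then coeff (n - Finsupp.single s 1) (g s) else 0) =
        if var n hn = s then coeff n f else 0 := by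
    by_cases hs : Finsupp.single s 1 ≤ n
    · simp only [if_pos hs, hg, tsub_add_cancel_of_le hs]
    · rw [if_neg hs, if_neg]
      rintro rfl
      exact hs (Finsupp.single_le_iff.2 (Nat.one_le_iff_ne_zero.2 (hvar n hn)))
  simp only [hterm, Finset.sum_ite_eq, Finset.mem_univ, if_true]

variable {K : Type*} [Field K] {k : ℕ} {f : MvPowerSeries σ K}

theorem mem_maximalIdeal_iff :
    f ∈ IsLocalRing.maximalIdeal (MvPowerSeries σ K) ↔ constantCoeff f = 0 := by
  rw [IsLocalRing.mem_maximalIdeal, mem_nonunits_iff, isUnit_iff_constantCoeff,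
    isUnit_iff_ne_zero, not_not]

theorem le_order_of_mem_maximalIdeal_pow
    (hf : f ∈ IsLocalRing.maximalIdeal (MvPowerSeries σ K) ^ k) : k ≤ f.order := by
  induction k generalizing f with
  | zero => simp
  | succ k ih =>
    rw [pow_succ] at hf
    induction hf using Submodule.mul_induction_on' with
    | mem_mul_mem a ha b hb =>
      push_cast
      exact (add_le_add (ih ha) (one_le_order_iff_constCoeff_eq_zero.2
        (mem_maximalIdeal_iff.1 hb))).trans le_order_mul
    | add a _ b _ iha ihb => exact (le_min iha ihb).trans min_order_le_add

theorem mem_maximalIdeal_pow_of_le_order [Finite σ] (hf : k ≤ f.order) :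
    f ∈ IsLocalRing.maximalIdeal (MvPowerSeries σ K) ^ k := by
  induction k generalizing f with
  | zero => simp
  | succ k ih =>
    have := Fintype.ofFinite σ
    obtain ⟨g, hfg, hg⟩ := exists_eq_sum_X_mul (one_le_order_iff_constCoeff_eq_zero.1
      (le_trans (by simp) hf))
    rw [hfg, pow_succ']
    refine Ideal.sum_mem _ fun s _ => Ideal.mul_mem_mul (mem_maximalIdeal_iff.2 (by simp))
      (ih (nat_le_order fun n hn => hg s n (coeff_of_lt_order (lt_of_lt_of_le ?_ hf))))
    simpa using hn

end MaximalIdeal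

section FiniteCodimension

variable {I : Ideal PS} {k ν n : ℕ}

theorem exists_hasHeight (hI : FiniteDimensional ℂ (PS ⧸ I)) : ∃ ν n, HasHeight I 0 ν n := by
  have := IsArtinianRing.of_finite ℂ (PS ⧸ I)
  obtain ⟨n, hn⟩ := IsLocalRing.exists_maximalIdeal_pow_le_of_isArtinianRing_quotient I
  have hpow (i : Fin 2) : (X i : PS) ^ n ∈ I :=
    hn (Ideal.pow_mem_pow (mem_maximalIdeal_iff.2 (constantCoeff_X i)) n)
  have hmem : (0, n) ∈ expo I := by
    refine ⟨_, hpow 1, ?_⟩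
    rw [X_pow_eq]
    simp [pt]
  have hne : {ν | (0, ν) ∈ expo I}.Nonempty := ⟨n, hmem⟩
  refine ⟨sInf {ν | (0, ν) ∈ expo I}, n, ⟨Set.mem_image_of_mem _ (Nat.sInf_mem hne), ?_⟩, ?_⟩
  · rintro _ ⟨e, he, rfl⟩
    obtain ⟨α, β⟩ := e
    rw [Prod.Lex.toLex_le_toLex]
    rcases α.eq_zero_or_pos with rfl | hα
    · exact .inr ⟨rfl, Nat.sInf_le he⟩
    · exact .inl hα
  · rw [zero_add]
    exact hpow 0

theorem le_maximalIdeal_pow_iff : I ≤ IsLocalRing.maximalIdeal PS ^ k ↔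
    k ∈ lowerBounds ((fun e : ℕ × ℕ => e.1 + e.2) '' expo I) := by
  constructor
  · rintro hI _ ⟨e, ⟨f, hf, hfe⟩, rfl⟩
    have hk : (k : ℕ∞) ≤ (pt e.1 e.2).degree :=
      (le_order_of_mem_maximalIdeal_pow (hI hf)).trans (order_le hfe)
    simpa [Finsupp.degree_eq_sum] using ENat.natCast_le_natCast.1 hk
  · refine fun h f hf => mem_maximalIdeal_pow_of_le_order (nat_le_order fun n hn => ?_)
    by_contra hne
    have hk : k ≤ n 0 + n 1 := h ⟨(n 0, n 1), ⟨f, hf, by simpa using hne⟩, rfl⟩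
    rw [Finsupp.degree_eq_sum, Fin.sum_univ_two] at hn
    omega

theorem HasHeight.hasDegreeSum_weight_of_transform {J : Ideal PS} (h : HasHeight J k ν n)
    (htransform : ∀ (σ : NewtonMap) (N d : ℕ) (F : MvPolynomial (Fin 2) ℂ), 0 < ν →
      IsFace J ⟨σ.p, σ.q, N⟩ → IsFaceData J ⟨σ.p, σ.q, N⟩ F d →
        HasDegreeSum (dicriticalVertices (σ.transform J)) Vertex.prodP
          ((dehom F).rootMultiplicity σ.μ)) (g : ℕ → ℕ → ℕ) :
    HasDegreeSum (dicriticalVertices J) (Vertex.weight g)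
      (∑ᶠ L ∈ latticeFaces (expo J), g L.p L.q * latticeLength (expo J) L) := by
  rcases ν.eq_zero_or_pos with rfl | hν
  · have hempty : latticeFaces (expo J) = ∅ := by
      have := biUnion_edgeHeights h.isLeast h.isLeast_snd
      rw [Set.Ioc_self] at this
      exact Set.eq_empty_of_forall_notMem fun L hL =>
        (IsLatticeFace.edgeHeights_nonempty hL).ne_empty
          (Set.subset_empty_iff.1 (this ▸ Set.subset_biUnion_of_mem hL))
    rw [dicriticalVertices_eq_empty h.isDepthZero, hempty]
    exact ⟨Set.finite_empty, by simp⟩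
  · exact hasDegreeSum_weight (finite_latticeFaces h.isLeast h.isLeast_snd)
      (h.isDepthZero_iff.not.2 hν.ne') (htransform · · · · hν) g

theorem HasHeight.hasDegreeSum_prodP {J : Ideal PS} (h : HasHeight J k ν n) :
    HasDegreeSum (dicriticalVertices J) Vertex.prodP ν := by
  induction ν using Nat.strong_induction_on generalizing J k n with
  | _ ν ihν =>
  induction n using Nat.strong_induction_on generalizing J k with
  | _ n ihn =>
  have hsum := h.hasDegreeSum_weight_of_transform (fun σ N d F hν hL hF => ?_) fun p _ => p
  · have hpolygon := finsum_p_mul_latticeLength h.isLeast h.isLeast_snd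
    rw [add_zero] at hpolygon
    rwa [funext Vertex.weight_fst, hpolygon] at hsum
  · have htransform := h.transform hL hF
    rcases h.transform_lt hν hL hF with hlt | ⟨heq, hlt⟩
    · exact ihν _ hlt htransform
    · rw [heq] at htransform ⊢
      exact ihn _ hlt htransform

theorem HasHeight.hasDegreeSum_weight {J : Ideal PS} (h : HasHeight J k ν n) (g : ℕ → ℕ → ℕ) :
    HasDegreeSum (dicriticalVertices J) (Vertex.weight g)
      (∑ᶠ L ∈ latticeFaces (expo J), g L.p L.q * latticeLength (expo J) L) :=
  h.hasDegreeSum_weight_of_transform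
    (fun _ _ _ _ _ hL hF => (h.transform hL hF).hasDegreeSum_prodP) g

end FiniteCodimension

end NewtonTree

theorem mainTheorem10 (I : Ideal NewtonTree.PS)
    (hI : FiniteDimensional ℂ (NewtonTree.PS ⧸ I)) :
    (NewtonTree.dicriticalVertices I).Finite ∧
      IsGreatest {k : ℕ | I ≤ IsLocalRing.maximalIdeal NewtonTree.PS ^ k}
        (∑ᶠ v ∈ NewtonTree.dicriticalVertices I, v.rho * v.d) := by
  obtain ⟨ν, n, hheight⟩ := NewtonTree.exists_hasHeight hI
  obtain ⟨m, horder⟩ : ∃ m, IsLeast ((fun e => e.1 + e.2) '' NewtonTree.expo I) m :=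
    ⟨_, isLeast_csInf (Set.Nonempty.image _ ⟨_, hheight.mem_expo⟩)⟩
  have hpolygon :=
    NewtonTree.finsum_min_mul_latticeLength hheight.isLeast hheight.isLeast_snd horder
  obtain ⟨hfinite, hsum⟩ := hheight.hasDegreeSum_weight min
  simp only [NewtonTree.Vertex.weight_min] at hsum
  rw [hsum.trans hpolygon]
  simp only [NewtonTree.le_maximalIdeal_pow_iff]
  exact ⟨hfinite, horder.isGLB⟩
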